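/- Let $0\le\alpha\le\frac12$. For a positive semidefinite matrix $A$ let $A^\alpha$ be its power on its support (the eigenvalue $0$ is sent to $0$, also when $\alpha=0$). For a unit vector $|\Phi\rangle\in\mathbb{C}^m\otimes\mathbb{C}^n$ with reduced state $\rho_A=\operatorname{tr}_B|\Phi\rangle\langle\Phi|$ put $$\mathcal{C}^t_\alpha(|\Phi\rangle)=\operatorname{tr}\rho_A^\alpha-1+\operatorname{tr}(I-\rho_A)^\alpha-\operatorname{tr}(I-\rho_A),$$ and for a state (density matrix) $\rho$ on $\mathbb{C}^m\otimes\mathbb{C}^n$ put $$\mathcal{C}^t_\alpha(\rho)=\inf\sum_i p_i\,\mathcal{C}^t_\alpha(|\Phi_i\rangle),$$ the infimum over all finite decompositions $\rho=\sum_i p_i|\Phi_i\rangle\langle\Phi_i|$ with unit vectors $|\Phi_i\rangle$, $p_i\ge0$ and $\sum_i p_i=1$. Then, for states of all finite local dimensions $m,n$, this infimum is taken over a non-empty set that is bounded below, and $\mathcal{C}^t_\alpha$ is a well-defined bipartite entanglement measure, that is: (E1) $\mathcal{C}^t_\alpha(\rho)\ge0$, with equality if and only if $\rho$ is separable (a finite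 convex combination of product states $\sigma_i\otimes\tau_i$). (E2) $\mathcal{C}^t_\alpha\big((U\otimes V)\rho(U\otimes V)^\dagger\big)=\mathcal{C}^t_\alpha(\rho)$ for all unitaries $U$ on $\mathbb{C}^m$ and $V$ on $\mathbb{C}^n$. (E3) $\mathcal{C}^t_\alpha(\rho)\ge\sum_i p_i\,\mathcal{C}^t_\alpha(\rho_i)$ whenever $(K_i)_i$ are the Kraus operators, labelled by the outcome records, of a finite-round LOCC protocol (possibly changing the local dimensions), where $p_i=\operatorname{tr}K_i\rho K_i^\dagger$ and $\rho_i=K_i\rho K_i^\dagger/p_i$; terms with $p_i=0$ count as $0$. (E4) $\mathcal{C}^t_\alpha\big(\sum_i p_i\rho_i\big)\le\sum_i p_i\,\mathcal{C}^t_\alpha(\rho_i)$ for all finite families of states $\rho_i$ on the same space and $p_i\ge0$ with $\sum_i p_i=1$. (E5) $\mathcal{C}^t_\alpha(\Lambda(\rho))\le\mathcal{C}^t_\alpha(\rho)$ for every LOCC map $\Lambda(X)=\sum_iK_iXK_i^\dagger$, with $(K_i)_i$ as in (E3). -/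

import Mathlib

open scoped Matrix Kronecker ComplexOrder

noncomputable section

namespace TotalConcurrence

/-- Square complex matrices on `ℂ^m ⊗ ℂ^n`. -/
abbrev BiMat (m n : ℕ) : Type := Matrix (Fin m × Fin n) (Fin m × Fin n) ℂ

/-- Density matrices: positive semidefinite of unit trace. -/
def IsState {ι : Type*} [Fintype ι] (ρ : Matrix ι ι ℂ) : Prop :=
  ρ.PosSemidef ∧ ρ.trace = 1

/-- Unit vectors. -/
def IsUnitVec {ι : Type*} [Fintype ι] (ψ : ι → ℂ) : Prop :=
  ∑ i, ‖ψ i‖ ^ 2 = 1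

/-- The rank-one operator `|ψ⟩⟨ψ|`. -/
def proj {ι : Type*} (ψ : ι → ℂ) : Matrix ι ι ℂ := Matrix.vecMulVec ψ (star ψ)

/-- Partial trace over the second factor. -/
def partialTraceB {m n : ℕ} (ρ : BiMat m n) : Matrix (Fin m) (Fin m) ℂ :=
  Matrix.of fun a a' => ∑ b, ρ (a, b) (a', b)

/-- The power `A ^ α` of a positive semidefinite matrix, taken on its support: in the functional
calculus the eigenvalue `0` is sent to `0`, also for `α = 0`, so that `A ^ 0` is the projection
onto the range of `A`. -/
def matPow {d : ℕ} (α : ℝ) (A : Matrix (Fin d) (Fin d) ℂ) : Matrix (Fin d) (Fin d) ℂ :=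
  cfc (fun x : ℝ => if x = 0 then 0 else x ^ α) A

/-- The total `α`-concurrence `tr ρ^α - 1 + tr (I - ρ)^α - tr (I - ρ)` of a state `ρ`
(all the traces are real). -/
def totalConc {d : ℕ} (α : ℝ) (ρ : Matrix (Fin d) (Fin d) ℂ) : ℝ :=
  (matPow α ρ).trace.re - 1 + (matPow α (1 - ρ)).trace.re - (1 - ρ).trace.re

/-- The total `α`-concurrence of a bipartite pure state, through its reduced state `ρ_A`. -/
def pureConc {m n : ℕ} (α : ℝ) (Φ : Fin m × Fin n → ℂ) : ℝ :=
  totalConc α (partialTraceB (proj Φ))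

/-- The averages `∑ i, p i * e (Φ i)` over all finite pure-state decompositions of `ρ`. -/
def roofValues {m n : ℕ} (e : (Fin m × Fin n → ℂ) → ℝ) (ρ : BiMat m n) : Set ℝ :=
  {x | ∃ (k : ℕ) (p : Fin k → ℝ) (Φ : Fin k → Fin m × Fin n → ℂ),
    (∀ i, 0 ≤ p i) ∧ ∑ i, p i = 1 ∧ (∀ i, IsUnitVec (Φ i)) ∧
    ρ = ∑ i, (p i : ℂ) • proj (Φ i) ∧ x = ∑ i, p i * e (Φ i)}

/-- The convex-roof extension of the pure-state total `α`-concurrence. -/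
def mixedConc (α : ℝ) (m n : ℕ) (ρ : BiMat m n) : ℝ :=
  sInf (roofValues (pureConc α) ρ)

/-- Separable states: finite convex combinations of product states. -/
def IsSeparable {m n : ℕ} (ρ : BiMat m n) : Prop :=
  ∃ (k : ℕ) (p : Fin k → ℝ) (σ : Fin k → Matrix (Fin m) (Fin m) ℂ)
    (τ : Fin k → Matrix (Fin n) (Fin n) ℂ),
    (∀ i, 0 ≤ p i) ∧ ∑ i, p i = 1 ∧ (∀ i, IsState (σ i)) ∧ (∀ i, IsState (τ i)) ∧
    ρ = ∑ i, (p i : ℂ) • (σ i ⊗ₖ τ i)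

/-- The Kraus operators, one for each record of measurement outcomes, of a finite-round LOCC
protocol from `ℂ^m ⊗ ℂ^n` to `ℂ^m' ⊗ ℂ^n'`. Either the protocol stops, or one of the parties
performs a complete measurement (whose operators may change the local dimension) and announces the
outcome, and the parties continue with an LOCC protocol that may depend on that outcome. -/
inductive IsLOCC (m' n' : ℕ) : ∀ (m n : ℕ) (κ : Type),
    (κ → Matrix (Fin m' × Fin n') (Fin m × Fin n) ℂ) → Prop
  | done : IsLOCC m' n' m' n' Unit (fun _ => 1)
  | alice (m n : ℕ) (ι : Type) [Fintype ι] (a : ι → ℕ)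
      (M : ∀ i, Matrix (Fin (a i)) (Fin m) ℂ) (hM : ∑ i, (M i)ᴴ * M i = 1)
      (κ : ι → Type) (K : ∀ i, κ i → Matrix (Fin m' × Fin n') (Fin (a i) × Fin n) ℂ)
      (hK : ∀ i, IsLOCC m' n' (a i) n (κ i) (K i)) :
      IsLOCC m' n' m n (Σ i, κ i)
        (fun x => K x.1 x.2 * (M x.1 ⊗ₖ (1 : Matrix (Fin n) (Fin n) ℂ)))
  | bob (m n : ℕ) (ι : Type) [Fintype ι] (b : ι → ℕ)
      (M : ∀ i, Matrix (Fin (b i)) (Fin n) ℂ) (hM : ∑ i, (M i)ᴴ * M i = 1)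
      (κ : ι → Type) (K : ∀ i, κ i → Matrix (Fin m' × Fin n') (Fin m × Fin (b i)) ℂ)
      (hK : ∀ i, IsLOCC m' n' m (b i) (κ i) (K i)) :
      IsLOCC m' n' m n (Σ i, κ i)
        (fun x => K x.1 x.2 * ((1 : Matrix (Fin m) (Fin m) ℂ) ⊗ₖ M x.1))

/-- LOCC maps: the outcomes of a finite-round LOCC protocol are discarded at the end. -/
def IsLOCCMap {m n m' n' : ℕ} (Λ : BiMat m n → BiMat m' n') : Prop :=
  ∃ (κ : Type) (_ : Fintype κ) (K : κ → Matrix (Fin m' × Fin n') (Fin m × Fin n) ℂ),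
    IsLOCC m' n' m n κ K ∧ ∀ X, Λ X = ∑ i, K i * X * (K i)ᴴ

/-- A well-defined bipartite entanglement measure, on the states of all finite local dimensions. -/
structure IsEntanglementMeasure (E : ∀ m n : ℕ, BiMat m n → ℝ) : Prop where
  /-- Nonnegativity. -/
  nonneg : ∀ (m n : ℕ) (ρ : BiMat m n), IsState ρ → 0 ≤ E m n ρ
  /-- Faithfulness. -/
  eq_zero_iff : ∀ (m n : ℕ) (ρ : BiMat m n), IsState ρ → (E m n ρ = 0 ↔ IsSeparable ρ)
  /-- Invariance under local unitaries. -/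
  local_unitary : ∀ (m n : ℕ) (ρ : BiMat m n), IsState ρ →
    ∀ U ∈ Matrix.unitaryGroup (Fin m) ℂ, ∀ V ∈ Matrix.unitaryGroup (Fin n) ℂ,
      E m n ((U ⊗ₖ V) * ρ * (Uᴴ ⊗ₖ Vᴴ)) = E m n ρ
  /-- No increase on average under LOCC. An outcome of probability zero contributes zero. -/
  locc_average : ∀ (m n m' n' : ℕ) (ρ : BiMat m n), IsState ρ →
    ∀ (κ : Type) [Fintype κ] (K : κ → Matrix (Fin m' × Fin n') (Fin m × Fin n) ℂ),
      IsLOCC m' n' m n κ K → ∀ p : κ → ℝ, (∀ i, p i = (K i * ρ * (K i)ᴴ).trace.re) →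
        ∑ i, p i * E m' n' (((p i)⁻¹ : ℂ) • (K i * ρ * (K i)ᴴ)) ≤ E m n ρ
  /-- Convexity. -/
  convex : ∀ (m n k : ℕ) (p : Fin k → ℝ) (ρ : Fin k → BiMat m n),
    (∀ i, 0 ≤ p i) → ∑ i, p i = 1 → (∀ i, IsState (ρ i)) →
      E m n (∑ i, (p i : ℂ) • ρ i) ≤ ∑ i, p i * E m n (ρ i)
  /-- No increase under LOCC maps. -/
  locc_map : ∀ (m n m' n' : ℕ) (ρ : BiMat m n), IsState ρ →
    ∀ Λ : BiMat m n → BiMat m' n', IsLOCCMap Λ → E m' n' (Λ ρ) ≤ E m n ρ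

end TotalConcurrence

end

open scoped Matrix Kronecker ComplexOrder

namespace TotalConcurrence

/-! For a unit vector with coefficient matrix `C` the reduced state is `C Cᴴ`. As its trace is one,
the concurrence is `tr f(C Cᴴ)` with `f x = x ^ α + (1 - x) ^ α - 1`. Three properties of `f` on
`[0, 1]` carry the proof: it is concave, it vanishes at `0` and `1`, and `x * (1 - x) ≤ f x`; the
last is where the threshold `1/2` enters.

Normalisation is removed by passing to `tr A * tr f(A / tr A)`, which has degree one and, by
concavity, is superadditive on positive semidefinite matrices (`sum_homSum_le`). The convex roof
becomes an infimum over decompositions into unnormalised vectors (`roofValues_eq_homRoof`). Joining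
and rescaling such decompositions makes it sublinear, whence convexity.

A measurement by one party splits the reduced operator of the other party into a sum over outcomes,
so superadditivity gives monotonicity on average for vectors. Either reduced operator may be used:
they share their nonzero spectrum and `f 0 = 0`. Applying the operators to each vector of a
decomposition and inducting on the protocol gives (E3); subadditivity then gives (E5).

On product vectors `C Cᴴ` is a multiple of a projection, so separable states have value zero.
Conversely, a vanishing infimum is not obviously attained, as `f` jumps at the endpoints when `α =
0`. The bound on `f` replaces the concurrence by the linear entropy, a continuous sum of squared
minors of `C`; compactness then yields an exact decomposition in which every vector of positive
weight has vanishing minors, hence is a product. -/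

/-- The sum of the values of `g` at the (real parts of the) eigenvalues of `A`, counted with
algebraic multiplicity. -/
noncomputable def spectralSum {ι : Type*} [Fintype ι] [DecidableEq ι] (g : ℝ → ℝ)
    (A : Matrix ι ι ℂ) : ℝ :=
  (A.charpoly.roots.map fun z => g z.re).sum

theorem trace_re_nonneg {ι : Type*} [Fintype ι] {A : Matrix ι ι ℂ} (hA : A.PosSemidef) :
    0 ≤ A.trace.re :=
  (Complex.nonneg_iff.1 hA.trace_nonneg).1

theorem diag_re_nonneg {ι : Type*} {A : Matrix ι ι ℂ} (hA : A.PosSemidef) (i : ι) : 0 ≤ (A i i).re :=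
  (Complex.nonneg_iff.1 hA.diag_nonneg).1

theorem ofReal_trace_re {ι : Type*} [Fintype ι] {A : Matrix ι ι ℂ} (hA : A.PosSemidef) :
    (A.trace.re : ℂ) = A.trace :=
  (Complex.nonneg_iff.1 hA.trace_nonneg).elim fun _ h => Complex.ext rfl h

theorem posSemidef_inv_smul {ι : Type*} [Fintype ι] {A : Matrix ι ι ℂ} (hA : A.PosSemidef) :
    ((A.trace.re⁻¹ : ℂ) • A).PosSemidef := by
  refine hA.smul ?_
  rw [← Complex.ofReal_inv, Complex.zero_le_real]
  exact inv_nonneg.2 (trace_re_nonneg hA)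

/-! ### Trace functions of concave functions and their superadditivity. -/

section SpectralSum

variable {ι κ : Type*} [Fintype ι] [DecidableEq ι] [Fintype κ] [DecidableEq κ]

theorem spectralSum_eq_sum_eigenvalues (g : ℝ → ℝ) {A : Matrix ι ι ℂ} (hA : A.IsHermitian) :
    spectralSum g A = ∑ i, g (hA.eigenvalues i) := by
  simp [spectralSum, hA.roots_charpoly_eq_eigenvalues]

/-- The characteristic polynomials of `A * B` and `B * A` agree up to powers of `X`, so the spectra
differ only in zeros, which `g 0 = 0` makes invisible. -/
theorem spectralSum_mul_comm {g : ℝ → ℝ} (hg : g 0 = 0) (A : Matrix ι κ ℂ) (B : Matrix κ ι ℂ) :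
    spectralSum g (A * B) = spectralSum g (B * A) := by
  have key := Matrix.charpoly_mul_comm' A B
  have h := congrArg Polynomial.roots key
  have h1 : (Polynomial.X ^ Fintype.card κ * (A * B).charpoly) ≠ 0 :=
    mul_ne_zero (pow_ne_zero _ Polynomial.X_ne_zero) (Matrix.charpoly_monic _).ne_zero
  have h2 : (Polynomial.X ^ Fintype.card ι * (B * A).charpoly) ≠ 0 :=
    mul_ne_zero (pow_ne_zero _ Polynomial.X_ne_zero) (Matrix.charpoly_monic _).ne_zero
  rw [Polynomial.roots_mul h1, Polynomial.roots_mul h2, Polynomial.roots_X_pow,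
    Polynomial.roots_X_pow] at h
  have h3 := congrArg (fun s => (s.map fun z : ℂ => g z.re).sum) h
  simpa [hg, spectralSum, Multiset.map_nsmul, Multiset.sum_nsmul] using h3

theorem spectralSum_unitary_conj (g : ℝ → ℝ) {U : Matrix ι ι ℂ} (hU : U * Uᴴ = 1)
    (A : Matrix ι ι ℂ) : spectralSum g (Uᴴ * A * U) = spectralSum g A := by
  unfold spectralSum
  rw [Matrix.mul_assoc, Matrix.charpoly_mul_comm, Matrix.mul_assoc, hU, Matrix.mul_one]

theorem exists_unitary_diagonal {A : Matrix ι ι ℂ} (hA : A.IsHermitian) :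
    ∃ U : Matrix ι ι ℂ, U * Uᴴ = 1 ∧ Uᴴ * U = 1 ∧
      A = U * Matrix.diagonal (fun i => (hA.eigenvalues i : ℂ)) * Uᴴ := by
  refine ⟨hA.eigenvectorUnitary, Unitary.coe_mul_star_self _, Unitary.coe_star_mul_self _, ?_⟩
  conv_lhs => rw [hA.spectral_theorem]
  rw [Unitary.conjStarAlgAut_apply]
  rfl

theorem spectralSum_diagonal (g : ℝ → ℝ) (d : ι → ℝ) :
    spectralSum g (Matrix.diagonal fun i => (d i : ℂ)) = ∑ i, g (d i) := by
  unfold spectralSum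
  rw [Matrix.charpoly_diagonal, Finset.prod, ← Function.comp_def (fun a => Polynomial.X - Polynomial.C a),
    ← Multiset.map_map, Polynomial.roots_multiset_prod_X_sub_C]
  simp

/-- The diagonal of a Hermitian matrix is majorized by its spectrum: a trace function of a
concave `g` is bounded by the sum of the values of `g` at the diagonal entries. -/
theorem spectralSum_le_sum_diag {g : ℝ → ℝ} {s : Set ℝ} (hg : ConcaveOn ℝ s g)
    {A : Matrix ι ι ℂ} (hA : A.IsHermitian) (hs : ∀ i, hA.eigenvalues i ∈ s) :
    spectralSum g A ≤ ∑ i, g (A i i).re := by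
  obtain ⟨U, h1, h2, h⟩ := exists_unitary_diagonal hA
  -- The weights `‖U i k‖ ^ 2` are doubly stochastic: row sums justify Jensen, column sums recover
  -- the spectral sum.
  have hrow (i : ι) : ∑ k, ‖U i k‖ ^ 2 = 1 := by
    have := congrFun (congrFun h1 i) i
    simp only [Matrix.mul_apply, Matrix.conjTranspose_apply, Matrix.one_apply_eq,
      RCLike.star_def, Complex.mul_conj, Complex.normSq_eq_norm_sq] at this
    exact_mod_cast this
  have hcol (k : ι) : ∑ i, ‖U i k‖ ^ 2 = 1 := by
    have := congrFun (congrFun h2 k) k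
    simp only [Matrix.mul_apply, Matrix.conjTranspose_apply, Matrix.one_apply_eq,
      RCLike.star_def, Complex.conj_mul'] at this
    exact_mod_cast this
  have hdiag (i : ι) : (A i i).re = ∑ k, ‖U i k‖ ^ 2 • hA.eigenvalues k := by
    have : A i i = ((∑ k, ‖U i k‖ ^ 2 • hA.eigenvalues k : ℝ) : ℂ) := by
      conv_lhs => rw [h]
      rw [Matrix.mul_apply]
      simp only [Matrix.mul_diagonal, Matrix.conjTranspose_apply]
      push_cast
      refine Finset.sum_congr rfl fun k _ => ?_
      rw [mul_right_comm, RCLike.star_def, Complex.mul_conj, Complex.normSq_eq_norm_sq]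
      rw [smul_eq_mul]; push_cast; rfl
    rw [this, Complex.ofReal_re]
  calc spectralSum g A = ∑ k, g (hA.eigenvalues k) := spectralSum_eq_sum_eigenvalues g hA
    _ = ∑ k, ∑ i, ‖U i k‖ ^ 2 • g (hA.eigenvalues k) := by
        refine Finset.sum_congr rfl fun k _ => ?_
        rw [← Finset.sum_smul, hcol, one_smul]
    _ = ∑ i, ∑ k, ‖U i k‖ ^ 2 • g (hA.eigenvalues k) := Finset.sum_comm
    _ ≤ ∑ i, g (A i i).re := Finset.sum_le_sum fun i _ => by
        rw [hdiag]
        exact hg.le_map_sum (fun k _ => by positivity) (hrow i) fun k _ => hs k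

/-- The perspective of a concave function is superadditive. -/
theorem sum_perspective_le {g : ℝ → ℝ} (hg : ConcaveOn ℝ (Set.Icc 0 1) g) {τ : Type*} [Fintype τ]
    {t x : τ → ℝ} (hx : ∀ i, 0 ≤ x i) (hxt : ∀ i, x i ≤ t i) :
    ∑ i, t i * g ((t i)⁻¹ * x i) ≤ (∑ i, t i) * g ((∑ i, t i)⁻¹ * ∑ i, x i) := by
  have ht : ∀ i, 0 ≤ t i := fun i => (hx i).trans (hxt i)
  rcases (Finset.sum_nonneg fun i (_ : i ∈ Finset.univ) => ht i).eq_or_lt with h0 | h0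
  · have : ∀ i, t i = 0 := fun i =>
      (Finset.sum_eq_zero_iff_of_nonneg fun i _ => ht i).1 h0.symm i (Finset.mem_univ i)
    simp [this]
  · set T := ∑ i, t i with hT
    have key := hg.le_map_sum (t := Finset.univ) (w := fun i => T⁻¹ * t i)
      (p := fun i => (t i)⁻¹ * x i) (fun i _ => mul_nonneg (inv_nonneg.2 h0.le) (ht i))
      (by rw [← Finset.mul_sum, ← hT, inv_mul_cancel₀ h0.ne'])
      (fun i _ => ⟨mul_nonneg (inv_nonneg.2 (ht i)) (hx i),
        inv_mul_le_one_of_le₀ (hxt i) (ht i)⟩)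
    have e : ∀ i, (T⁻¹ * t i) • ((t i)⁻¹ * x i) = T⁻¹ * x i := fun i => by
      rcases eq_or_ne (t i) 0 with h | h
      · have : x i = 0 := le_antisymm (h ▸ hxt i) (hx i)
        simp [this]
      · rw [smul_eq_mul]; field_simp
    simp only [e, smul_eq_mul, mul_assoc] at key
    rw [← Finset.mul_sum, ← Finset.mul_sum] at key
    rwa [inv_mul_le_iff₀ h0] at key

/-- The homogeneous extension of the trace function of `g` to all positive semidefinite
matrices. -/
noncomputable def homSum (g : ℝ → ℝ) (A : Matrix ι ι ℂ) : ℝ :=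
  A.trace.re * spectralSum g ((A.trace.re⁻¹ : ℂ) • A)

theorem eigenvalues_sum_eq_trace_re {A : Matrix ι ι ℂ} (hA : A.IsHermitian) :
    ∑ i, hA.eigenvalues i = A.trace.re := by
  rw [hA.trace_eq_sum_eigenvalues]
  simp

theorem eigenvalues_mem_Icc {A : Matrix ι ι ℂ} (hA : A.PosSemidef) (ht : A.trace.re ≤ 1) (i : ι) :
    hA.isHermitian.eigenvalues i ∈ Set.Icc (0 : ℝ) 1 := by
  refine ⟨hA.eigenvalues_nonneg i, le_trans ?_ ht⟩
  rw [← eigenvalues_sum_eq_trace_re hA.isHermitian]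
  exact Finset.single_le_sum (f := hA.isHermitian.eigenvalues)
    (fun j _ => hA.eigenvalues_nonneg j) (Finset.mem_univ i)

theorem homSum_le_sum_diag {g : ℝ → ℝ} (hg : ConcaveOn ℝ (Set.Icc 0 1) g) {A : Matrix ι ι ℂ}
    (hA : A.PosSemidef) :
    homSum g A ≤ ∑ i, A.trace.re * g (A.trace.re⁻¹ * (A i i).re) := by
  have h0 := trace_re_nonneg hA
  have hB := posSemidef_inv_smul hA
  rw [← Finset.mul_sum, homSum]
  refine mul_le_mul_of_nonneg_left ?_ h0
  refine (spectralSum_le_sum_diag hg hB.isHermitian (eigenvalues_mem_Icc hB ?_)).trans_eq ?_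
  · rw [Matrix.trace_smul, smul_eq_mul, ← Complex.ofReal_inv, Complex.re_ofReal_mul]
    exact inv_mul_le_one
  · refine Finset.sum_congr rfl fun i _ => ?_
    rw [Matrix.smul_apply, smul_eq_mul, ← Complex.ofReal_inv, Complex.re_ofReal_mul]

theorem homSum_unitary_conj (g : ℝ → ℝ) {U : Matrix ι ι ℂ} (hU : U * Uᴴ = 1)
    (A : Matrix ι ι ℂ) : homSum g (Uᴴ * A * U) = homSum g A := by
  have ht : (Uᴴ * A * U).trace = A.trace := by
    rw [Matrix.trace_mul_comm, ← Matrix.mul_assoc, hU, Matrix.one_mul]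
  rw [homSum, homSum, ht, ← spectralSum_unitary_conj g hU (_ • A), Matrix.mul_smul, Matrix.smul_mul]

theorem homSum_mul_comm {g : ℝ → ℝ} (hg : g 0 = 0) (A : Matrix ι κ ℂ) (B : Matrix κ ι ℂ) :
    homSum g (A * B) = homSum g (B * A) := by
  rw [homSum, homSum, Matrix.trace_mul_comm, ← Matrix.smul_mul, spectralSum_mul_comm hg,
    Matrix.mul_smul]

theorem homSum_smul (g : ℝ → ℝ) {c : ℝ} (A : Matrix ι ι ℂ) :
    homSum g ((c : ℂ) • A) = c * homSum g A := by
  rcases eq_or_ne c 0 with rfl | h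
  · simp [homSum]
  · have : ((c : ℂ) • A).trace.re = c * A.trace.re := by
      rw [Matrix.trace_smul, smul_eq_mul, Complex.re_ofReal_mul]
    rw [homSum, homSum, this, smul_smul]
    have hc : ((c * A.trace.re : ℝ) : ℂ)⁻¹ * c = (A.trace.re : ℂ)⁻¹ := by
      push_cast
      have : (c : ℂ) ≠ 0 := by exact_mod_cast h
      rw [mul_inv, mul_comm, ← mul_assoc, mul_inv_cancel₀ this, one_mul]
    rw [hc, mul_assoc]

/-- The homogeneous trace function of a concave `g` is superadditive. -/
theorem sum_homSum_le {g : ℝ → ℝ} (hg : ConcaveOn ℝ (Set.Icc 0 1) g) {τ : Type*} [Fintype τ]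
    {A : τ → Matrix ι ι ℂ} (hA : ∀ i, (A i).PosSemidef) :
    ∑ i, homSum g (A i) ≤ homSum g (∑ i, A i) := by
  have hS : (∑ i, A i).PosSemidef := Matrix.posSemidef_sum _ fun i _ => hA i
  -- In an eigenbasis of the sum, the diagonal bound is an equality for the sum and an upper bound
  -- for each summand; the scalar perspective inequality compares the two, entry by entry.
  obtain ⟨U, h1, h2, h⟩ := exists_unitary_diagonal hS.isHermitian
  set d := hS.isHermitian.eigenvalues with hd
  have hsum : ∑ i, Uᴴ * A i * U = Matrix.diagonal fun j => (d j : ℂ) := by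
    rw [← Finset.sum_mul, ← Finset.mul_sum, h]
    simp only [← Matrix.mul_assoc]
    rw [h2, Matrix.one_mul, Matrix.mul_assoc, h2, Matrix.mul_one]
  have hB (i : τ) : (Uᴴ * A i * U).PosSemidef := (hA i).conjTranspose_mul_mul_same U
  have htr (i : τ) : (Uᴴ * A i * U).trace.re = ∑ j, ((Uᴴ * A i * U) j j).re := by
    simp [Matrix.trace]
  have hdj (j : ι) : d j = ∑ i, ((Uᴴ * A i * U) j j).re := by
    have := congrArg Complex.re (congrFun (congrFun hsum j) j)
    rw [Matrix.diagonal_apply_eq, Complex.ofReal_re] at this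
    rw [← this, Matrix.sum_apply, Complex.re_sum]
  have hT : (∑ j, (d j : ℂ)).re = ∑ i, (Uᴴ * A i * U).trace.re := by
    simp only [Complex.re_sum, Complex.ofReal_re, htr, hdj]
    rw [Finset.sum_comm]
  calc ∑ i, homSum g (A i) = ∑ i, homSum g (Uᴴ * A i * U) := by
        simp only [homSum_unitary_conj g h1]
    _ ≤ ∑ i, ∑ j, (Uᴴ * A i * U).trace.re *
          g ((Uᴴ * A i * U).trace.re⁻¹ * ((Uᴴ * A i * U) j j).re) :=
        Finset.sum_le_sum fun i _ => homSum_le_sum_diag hg (hB i)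
    _ = ∑ j, ∑ i, (Uᴴ * A i * U).trace.re *
          g ((Uᴴ * A i * U).trace.re⁻¹ * ((Uᴴ * A i * U) j j).re) := Finset.sum_comm
    _ ≤ ∑ j, (∑ i, (Uᴴ * A i * U).trace.re) *
          g ((∑ i, (Uᴴ * A i * U).trace.re)⁻¹ * d j) :=
        Finset.sum_le_sum fun j _ => by
          rw [hdj]
          refine sum_perspective_le hg (fun i => diag_re_nonneg (hB i) j) fun i => ?_
          rw [htr]
          exact Finset.single_le_sum (f := fun j => ((Uᴴ * A i * U) j j).re)
            (fun j _ => diag_re_nonneg (hB i) j) (Finset.mem_univ j)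
    _ = homSum g (∑ i, Uᴴ * A i * U) := by
        rw [hsum, homSum, Matrix.trace_diagonal, hT, ← Finset.mul_sum, ← Complex.ofReal_inv,
          ← Matrix.diagonal_smul]
        congr 1
        rw [← spectralSum_diagonal]
        congr 1
        ext i j
        simp [Matrix.diagonal_apply]
    _ = homSum g (∑ i, A i) := by
        rw [← Finset.sum_mul, ← Finset.mul_sum, homSum_unitary_conj g h1]

end SpectralSum

/-! ### Compactness of convex hulls. -/

/-- Convex hulls of compact sets in finite-dimensional spaces are compact. -/
theorem isCompact_convexHull {E : Type*} [AddCommGroup E] [Module ℝ E] [TopologicalSpace E]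
    [ContinuousAdd E] [ContinuousSMul ℝ E] [FiniteDimensional ℝ E] {s : Set E}
    (hs : IsCompact s) : IsCompact (convexHull ℝ s) := by
  -- By Carathéodory this many points always suffice, so the hull is a continuous image of a simplex
  -- times a power of `s`.
  let N := Module.finrank ℝ E + 1
  let F : (Fin N → ℝ) × (Fin N → E) → E := fun q => ∑ i, q.1 i • q.2 i
  have hF : Continuous F := by fun_prop
  have hc : IsCompact (F '' (stdSimplex ℝ (Fin N) ×ˢ Set.univ.pi fun _ => s)) :=
    ((isCompact_stdSimplex ℝ (Fin N)).prod (isCompact_univ_pi fun _ => hs)).image hF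
  convert hc
  apply Set.Subset.antisymm
  · intro x hx
    obtain ⟨ι, _, z, w, hz, hind, hw0, hw1, hx⟩ := eq_pos_convex_span_of_mem_convexHull hx
    have hcard : Fintype.card ι ≤ Fintype.card (Fin N) := by
      rw [Fintype.card_fin]
      exact hind.card_le_finrank_succ.trans
        (Nat.succ_le_succ (Submodule.finrank_le _))
    obtain ⟨e⟩ := Function.Embedding.nonempty_of_card_le hcard
    have : Nonempty ι := by
      by_contra h
      rw [not_nonempty_iff] at h
      simp at hw1
    let i₀ : ι := Classical.arbitrary ι
    -- Unused slots get weight `0` and a dummy point of `s`.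
    refine ⟨(fun j => Function.extend e w (0 : Fin N → ℝ) j,
        fun j => Function.extend e z (fun _ => z i₀) j),
      ⟨⟨fun j => ?_, ?_⟩, fun j _ => ?_⟩, ?_⟩
    · by_cases hj : ∃ i, e i = j
      · obtain ⟨i, rfl⟩ := hj
        simpa [e.injective.extend_apply] using (hw0 i).le
      · simp [Function.extend_apply' _ _ _ hj]
    · rw [← hw1]
      exact (Fintype.sum_of_injective e e.injective _ _
        (fun j hj => Function.extend_apply' w (0 : Fin N → ℝ) j hj)
        fun i => (e.injective.extend_apply w (0 : Fin N → ℝ) i).symm).symm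
    · by_cases hj : ∃ i, e i = j
      · obtain ⟨i, rfl⟩ := hj
        simpa [e.injective.extend_apply] using hz ⟨i, rfl⟩
      · simpa [Function.extend_apply' _ _ _ hj] using hz ⟨i₀, rfl⟩
    · rw [← hx]
      refine (Fintype.sum_of_injective e e.injective _ _ (fun j hj => ?_) fun i => ?_).symm
      · simp [Function.extend_apply' _ _ _ hj]
      · simp [e.injective.extend_apply]
  · rintro _ ⟨⟨w, z⟩, ⟨hw, hz⟩, rfl⟩
    exact mem_convexHull_of_exists_fintype w z hw.1 hw.2 (fun i => hz i trivial) rfl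

/-! ### The scalar profile: concavity and a quadratic lower bound. -/

/-- The power function on the support: `0` is sent to `0`, also for exponent `0`. -/
noncomputable def supportPow (α x : ℝ) : ℝ := if x = 0 then 0 else x ^ α

/-- The contribution `x ^ α + (1 - x) ^ α - 1` of an eigenvalue `x` to the total concurrence. -/
noncomputable def concProfile (α x : ℝ) : ℝ := supportPow α x + supportPow α (1 - x) - 1

theorem concProfile_zero (α : ℝ) : concProfile α 0 = 0 := by
  simp [concProfile, supportPow]

theorem concProfile_one (α : ℝ) : concProfile α 1 = 0 := by
  simp [concProfile, supportPow]

theorem concaveOn_supportPow {α : ℝ} (hα₀ : 0 ≤ α) (hα₁ : α ≤ 1) :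
    ConcaveOn ℝ (Set.Ici 0) (supportPow α) := by
  rcases hα₀.eq_or_lt with rfl | h
  -- For exponent `0` this is the indicator of the positive reals, which is concave on the closed
  -- half-line.
  · refine ⟨convex_Ici 0, fun x hx y hy a b ha hb hab => ?_⟩
    have h1 (z : ℝ) : supportPow 0 z ≤ 1 := by
      unfold supportPow; split_ifs <;> simp
    have hx' : 0 ≤ a * x := mul_nonneg ha hx
    have hy' : 0 ≤ b * y := mul_nonneg hb hy
    simp only [smul_eq_mul]
    by_cases hz : a * x + b * y = 0
    · have e1 : a * x = 0 := by linarith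
      have e2 : b * y = 0 := by linarith
      have f1 : a * supportPow 0 x = 0 := by
        rcases mul_eq_zero.1 e1 with h | h <;> simp [h, supportPow]
      have f2 : b * supportPow 0 y = 0 := by
        rcases mul_eq_zero.1 e2 with h | h <;> simp [h, supportPow]
      rw [f1, f2, hz]
      simp [supportPow]
    · have : supportPow 0 (a * x + b * y) = 1 := by simp [supportPow, hz]
      rw [this]
      nlinarith [mul_le_mul_of_nonneg_left (h1 x) ha, mul_le_mul_of_nonneg_left (h1 y) hb]
  · refine (Real.concaveOn_rpow hα₀ hα₁).congr fun x _ => ?_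
    unfold supportPow
    split_ifs with hx
    · simp [hx, Real.zero_rpow h.ne']
    · rfl

theorem concaveOn_concProfile {α : ℝ} (hα₀ : 0 ≤ α) (hα₁ : α ≤ 1) :
    ConcaveOn ℝ (Set.Icc 0 1) (concProfile α) := by
  have h := concaveOn_supportPow hα₀ hα₁
  refine ⟨convex_Icc 0 1, fun x hx y hy a b ha hb hab => ?_⟩
  have h1 := h.2 (Set.mem_Ici.2 hx.1) (Set.mem_Ici.2 hy.1) ha hb hab
  have h2 := h.2 (Set.mem_Ici.2 (sub_nonneg.2 hx.2)) (Set.mem_Ici.2 (sub_nonneg.2 hy.2)) ha hb hab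
  have e : a • (1 - x) + b • (1 - y) = 1 - (a • x + b • y) := by
    simp only [smul_eq_mul]; linear_combination hab
  rw [e] at h2
  simp only [concProfile, smul_eq_mul] at *
  linear_combination h1 + h2 - hab

/-- On `[0, 1]` the power is at least `√x`. With `s = √x` the gap to the quadratic is `s * (1 - s) *
(2 - s - s ^ 2) / 2`. Adding the bounds at `x` and `1 - x` leaves exactly `x * (1 - x)` for the
profile. -/
theorem le_supportPow {α : ℝ} (hα₁ : α ≤ 1 / 2) {x : ℝ} (hx₀ : 0 ≤ x)
    (hx₁ : x ≤ 1) : x + x * (1 - x) / 2 ≤ supportPow α x := by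
  unfold supportPow
  split_ifs with h
  · simp [h]
  · have hpos : 0 < x := lt_of_le_of_ne hx₀ (Ne.symm h)
    have h1 : √x ≤ x ^ α := by
      rw [Real.sqrt_eq_rpow]
      exact Real.rpow_le_rpow_of_exponent_ge hpos hx₁ hα₁
    refine le_trans ?_ h1
    have hs := Real.sq_sqrt hx₀
    have hs0 := Real.sqrt_nonneg x
    have hs1 : √x ≤ 1 := by simpa using Real.sqrt_le_sqrt hx₁
    generalize √x = s at *
    subst hs
    have : 0 ≤ s * (1 - s) * (2 - s - s ^ 2) :=
      mul_nonneg (mul_nonneg hs0 (by linarith)) (by nlinarith)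
    nlinarith

theorem le_concProfile {α : ℝ} (hα₁ : α ≤ 1 / 2) {x : ℝ}
    (hx : x ∈ Set.Icc (0 : ℝ) 1) : x * (1 - x) ≤ concProfile α x := by
  have h1 := le_supportPow hα₁ hx.1 hx.2
  have h2 := le_supportPow hα₁ (sub_nonneg.2 hx.2) (sub_le_self 1 hx.1)
  unfold concProfile
  linarith

theorem concProfile_nonneg {α : ℝ} (hα₁ : α ≤ 1 / 2) {x : ℝ}
    (hx : x ∈ Set.Icc (0 : ℝ) 1) : 0 ≤ concProfile α x :=
  (mul_nonneg hx.1 (sub_nonneg.2 hx.2)).trans (le_concProfile hα₁ hx)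

/-! ### From the functional calculus to spectral sums. -/

theorem trace_cfc {ι : Type*} [Fintype ι] [DecidableEq ι] {A : Matrix ι ι ℂ} (hA : A.IsHermitian)
    (f : ℝ → ℝ) : (cfc f A).trace = ((∑ i, f (hA.eigenvalues i) : ℝ) : ℂ) := by
  rw [hA.cfc_eq, Matrix.IsHermitian.cfc, Unitary.conjStarAlgAut_apply, Matrix.trace_mul_comm,
    ← Matrix.mul_assoc, Unitary.coe_star_mul_self, Matrix.one_mul, Matrix.trace_diagonal]
  simp

/-- Trace one turns the constants `-1 - tr (1 - A)` into `-d`, that is, one `-1` for each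
eigenvalue. -/
theorem totalConc_eq_spectralSum {d : ℕ} (α : ℝ) {A : Matrix (Fin d) (Fin d) ℂ}
    (hA : A.IsHermitian) (htr : A.trace = 1) :
    totalConc α A = spectralSum (concProfile α) A := by
  have hA' : IsSelfAdjoint A := hA
  have hfin : (spectrum ℝ A).Finite := A.finite_real_spectrum
  have h1 : (matPow α A).trace = ((∑ i, supportPow α (hA.eigenvalues i) : ℝ) : ℂ) :=
    trace_cfc hA (supportPow α)
  have h2 : (matPow α (1 - A)).trace = ((∑ i, supportPow α (1 - hA.eigenvalues i) : ℝ) : ℂ) := by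
    have e : 1 - A = cfc (fun x : ℝ => 1 - x) A := by
      rw [cfc_sub (fun _ : ℝ => (1 : ℝ)) (fun x => x) A, cfc_const_one ℝ A, cfc_id' ℝ A]
    change (cfc (supportPow α) (1 - A)).trace = _
    -- The spectrum is finite, so continuity on it is automatic even where the power jumps.
    rw [e, ← cfc_comp (supportPow α) (fun x : ℝ => 1 - x) A hA'
      ((hfin.image _).continuousOn _) (hfin.continuousOn _), trace_cfc hA]
    rfl
  have h3 := eigenvalues_sum_eq_trace_re hA
  rw [totalConc, h1, h2, spectralSum_eq_sum_eigenvalues _ hA, Complex.ofReal_re, Complex.ofReal_re,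
    Matrix.trace_sub, htr, Matrix.trace_one, Fintype.card_fin]
  simp [concProfile, Finset.sum_sub_distrib, Finset.sum_add_distrib]
  ring

theorem homSum_concProfile_nonneg {ι : Type*} [Fintype ι] [DecidableEq ι] {α : ℝ}
    (hα₁ : α ≤ 1 / 2) {A : Matrix ι ι ℂ} (hA : A.PosSemidef) :
    0 ≤ homSum (concProfile α) A := by
  have hB := posSemidef_inv_smul hA
  rw [homSum, spectralSum_eq_sum_eigenvalues _ hB.isHermitian]
  refine mul_nonneg (trace_re_nonneg hA) (Finset.sum_nonneg fun i _ => concProfile_nonneg hα₁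
    (eigenvalues_mem_Icc hB ?_ i))
  rw [Matrix.trace_smul, smul_eq_mul, ← Complex.ofReal_inv, Complex.re_ofReal_mul]
  exact inv_mul_le_one

/-- The linear entropy bounds the total concurrence from below. -/
theorem one_sub_trace_sq_le {ι : Type*} [Fintype ι] [DecidableEq ι] {α : ℝ}
    (hα₁ : α ≤ 1 / 2) {A : Matrix ι ι ℂ} (hA : A.PosSemidef) (htr : A.trace = 1) :
    1 - (A * A).trace.re ≤ spectralSum (concProfile α) A := by
  have h3 := eigenvalues_sum_eq_trace_re hA.isHermitian
  have h4 : (A * A).trace = ((∑ i, hA.isHermitian.eigenvalues i ^ 2 : ℝ) : ℂ) := by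
    have hA' : IsSelfAdjoint A := hA.isHermitian
    rw [← pow_two, ← cfc_pow_id (R := ℝ) A 2, trace_cfc hA.isHermitian]
  rw [spectralSum_eq_sum_eigenvalues _ hA.isHermitian, h4, Complex.ofReal_re]
  rw [htr, Complex.one_re] at h3
  rw [← h3, ← Finset.sum_sub_distrib]
  refine Finset.sum_le_sum fun i _ => (le_of_eq (by ring)).trans
    (le_concProfile hα₁ (eigenvalues_mem_Icc hA (by simp [htr]) i))

/-- The trace function of the concurrence profile vanishes on orthogonal projections. -/
theorem spectralSum_concProfile_eq_zero {ι : Type*} [Fintype ι] [DecidableEq ι] (α : ℝ)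
    {A : Matrix ι ι ℂ} (hA : A.IsHermitian) (h : A * A = A) :
    spectralSum (concProfile α) A = 0 := by
  rw [spectralSum_eq_sum_eigenvalues _ hA]
  refine Finset.sum_eq_zero fun i _ => ?_
  obtain ⟨U, h1, h2, hU⟩ := exists_unitary_diagonal hA
  have hD : Matrix.diagonal (fun i => (hA.eigenvalues i : ℂ)) = Uᴴ * A * U := by
    conv_rhs => rw [hU]
    simp only [← Matrix.mul_assoc]
    rw [h2, Matrix.one_mul, Matrix.mul_assoc, h2, Matrix.mul_one]
  have hDD : Matrix.diagonal (fun i => (hA.eigenvalues i : ℂ)) *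
      Matrix.diagonal (fun i => (hA.eigenvalues i : ℂ)) =
      Matrix.diagonal (fun i => (hA.eigenvalues i : ℂ)) := by
    rw [hD]
    calc Uᴴ * A * U * (Uᴴ * A * U) = Uᴴ * A * (U * Uᴴ) * A * U := by
          simp only [Matrix.mul_assoc]
      _ = Uᴴ * (A * A) * U := by rw [h1, Matrix.mul_one]; simp only [Matrix.mul_assoc]
      _ = Uᴴ * A * U := by rw [h]
  have := congrFun (congrFun hDD i) i
  rw [Matrix.diagonal_mul_diagonal, Matrix.diagonal_apply_eq, Matrix.diagonal_apply_eq] at this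
  have hi : hA.eigenvalues i * hA.eigenvalues i = hA.eigenvalues i := by exact_mod_cast this
  rcases (IsIdempotentElem.iff_eq_zero_or_one.1 hi).symm with h | h
  · rw [h, concProfile_one]
  · rw [h, concProfile_zero]

/-! ### Concurrence of vectors and local operations. -/

/-- The coefficient matrix of a bipartite vector. -/
def coeffMat {m n : ℕ} (Ψ : Fin m × Fin n → ℂ) : Matrix (Fin m) (Fin n) ℂ :=
  Matrix.of fun a b => Ψ (a, b)

/-- The homogeneous extension of the pure-state total concurrence to all vectors. -/
noncomputable def homConc {m n : ℕ} (α : ℝ) (Ψ : Fin m × Fin n → ℂ) : ℝ :=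
  homSum (concProfile α) (coeffMat Ψ * (coeffMat Ψ)ᴴ)

section Pure

variable {m n : ℕ}

theorem partialTraceB_proj (Ψ : Fin m × Fin n → ℂ) :
    partialTraceB (proj Ψ) = coeffMat Ψ * (coeffMat Ψ)ᴴ := by
  ext a a'
  simp [partialTraceB, proj, coeffMat, Matrix.mul_apply, Matrix.vecMulVec_apply]

theorem trace_proj {ι : Type*} [Fintype ι] (ψ : ι → ℂ) :
    (proj ψ).trace = ((∑ i, ‖ψ i‖ ^ 2 : ℝ) : ℂ) := by
  simp only [proj, Matrix.trace, Matrix.diag_apply, Matrix.vecMulVec_apply, Pi.star_apply,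
    RCLike.star_def, Complex.mul_conj, Complex.normSq_eq_norm_sq]
  push_cast
  rfl

theorem posSemidef_proj {ι : Type*} [Fintype ι] (ψ : ι → ℂ) : (proj ψ).PosSemidef :=
  Matrix.posSemidef_vecMulVec_self_star ψ

theorem trace_coeffMat_mul (Ψ : Fin m × Fin n → ℂ) :
    (coeffMat Ψ * (coeffMat Ψ)ᴴ).trace = ((∑ i, ‖Ψ i‖ ^ 2 : ℝ) : ℂ) := by
  rw [← trace_proj, ← partialTraceB_proj]
  simp [Matrix.trace, partialTraceB, Fintype.sum_prod_type]

theorem coeffMat_kronecker_mulVec {m' n' : ℕ} (A : Matrix (Fin m') (Fin m) ℂ)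
    (B : Matrix (Fin n') (Fin n) ℂ) (Ψ : Fin m × Fin n → ℂ) :
    coeffMat ((A ⊗ₖ B) *ᵥ Ψ) = A * coeffMat Ψ * Bᵀ := by
  ext a b
  simp only [coeffMat, Matrix.of_apply, Matrix.mulVec, dotProduct, Matrix.kroneckerMap_apply,
    Fintype.sum_prod_type, Matrix.mul_apply, Matrix.transpose_apply, Finset.sum_mul]
  rw [Finset.sum_comm]
  exact Finset.sum_congr rfl fun _ _ => Finset.sum_congr rfl fun _ _ => by ring

theorem proj_mulVec {ι κ : Type*} [Fintype ι] [Fintype κ] (L : Matrix κ ι ℂ) (ψ : ι → ℂ) :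
    proj (L *ᵥ ψ) = L * proj ψ * Lᴴ := by
  rw [proj, proj, Matrix.mul_vecMulVec, Matrix.vecMulVec_mul, Matrix.star_mulVec]

theorem proj_sqrt_smul {ι : Type*} {c : ℝ} (hc : 0 ≤ c) (ψ : ι → ℂ) :
    proj ((√c : ℂ) • ψ) = (c : ℂ) • proj ψ := by
  have h : (√c : ℂ) * √c = c := by exact_mod_cast Real.mul_self_sqrt hc
  ext i j
  simp only [proj, Matrix.vecMulVec_apply, Pi.smul_apply, Pi.star_apply, smul_eq_mul,
    Matrix.smul_apply, star_mul', RCLike.star_def, Complex.conj_ofReal]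
  linear_combination ψ i * (starRingEnd ℂ) (ψ j) * h

/-- Degree one in the rank-one operator: this lets probabilities be absorbed into the vectors. -/
theorem homConc_sqrt_smul (α : ℝ) {c : ℝ} (hc : 0 ≤ c) (Ψ : Fin m × Fin n → ℂ) :
    homConc α ((√c : ℂ) • Ψ) = c * homConc α Ψ := by
  have : partialTraceB ((c : ℂ) • proj Ψ) = (c : ℂ) • partialTraceB (proj Ψ) := by
    ext a a'
    simp [partialTraceB, Finset.mul_sum]
  rw [homConc, homConc, ← partialTraceB_proj, proj_sqrt_smul hc, this, homSum_smul,
    partialTraceB_proj]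

theorem pureConc_eq_homConc (α : ℝ) {Φ : Fin m × Fin n → ℂ} (hΦ : IsUnitVec Φ) :
    pureConc α Φ = homConc α Φ := by
  have ht : (coeffMat Φ * (coeffMat Φ)ᴴ).trace = 1 := by
    rw [trace_coeffMat_mul, hΦ, Complex.ofReal_one]
  rw [pureConc, partialTraceB_proj,
    totalConc_eq_spectralSum α (Matrix.isHermitian_mul_conjTranspose_self _) ht, homConc, homSum,
    ht]
  simp

theorem homConc_nonneg {α : ℝ} (hα₁ : α ≤ 1 / 2) (Ψ : Fin m × Fin n → ℂ) : 0 ≤ homConc α Ψ :=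
  homSum_concProfile_nonneg hα₁ (Matrix.posSemidef_self_mul_conjTranspose _)

theorem exists_unit_smul (Ψ : Fin m × Fin n → ℂ) (i₀ : Fin m × Fin n) :
    ∃ Φ : Fin m × Fin n → ℂ, IsUnitVec Φ ∧ Ψ = (√(∑ i, ‖Ψ i‖ ^ 2) : ℂ) • Φ := by
  rcases (Finset.sum_nonneg fun i (_ : i ∈ Finset.univ) => sq_nonneg ‖Ψ i‖).eq_or_lt with h | h
  -- The zero vector has weight `0`, so any unit vector serves.
  · refine ⟨Pi.single i₀ 1, ?_, ?_⟩
    · rw [IsUnitVec, Finset.sum_eq_single i₀] <;> simp +contextual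
    · have : Ψ = 0 := by
        ext i
        simpa using (Finset.sum_eq_zero_iff_of_nonneg fun i _ => sq_nonneg ‖Ψ i‖).1 h.symm i
      rw [← h, this]
      simp
  · set N := ∑ i, ‖Ψ i‖ ^ 2 with hN
    have hs : (√N : ℂ) ≠ 0 := by exact_mod_cast (Real.sqrt_pos.2 h).ne'
    refine ⟨(√N : ℂ)⁻¹ • Ψ, ?_, by rw [smul_smul, mul_inv_cancel₀ hs, one_smul]⟩
    simp only [IsUnitVec, Pi.smul_apply, smul_eq_mul, norm_mul, mul_pow, ← Finset.mul_sum, ← hN,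
      norm_inv, Complex.norm_real, inv_pow, Real.norm_eq_abs, sq_abs, Real.sq_sqrt h.le]
    exact inv_mul_cancel₀ h.ne'

/-- The total concurrence of a vector does not increase on average under a measurement of the
first party. -/
theorem sum_homConc_left_le {α : ℝ} (hα₀ : 0 ≤ α) (hα₁ : α ≤ 1 / 2) {ι : Type*} [Fintype ι]
    {a : ι → ℕ} (M : ∀ i, Matrix (Fin (a i)) (Fin m) ℂ) (hM : ∑ i, (M i)ᴴ * M i = 1)
    (Ψ : Fin m × Fin n → ℂ) :
    ∑ i, homConc α ((M i ⊗ₖ (1 : Matrix (Fin n) (Fin n) ℂ)) *ᵥ Ψ) ≤ homConc α Ψ := by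
  have hg := concaveOn_concProfile hα₀ (hα₁.trans (by norm_num))
  have h0 := concProfile_zero α
  -- The first party acts on the left of `C`, so it is `Cᴴ C`, not `C Cᴴ`, that splits over the
  -- outcomes.
  have e (i : ι) : homConc α ((M i ⊗ₖ (1 : Matrix (Fin n) (Fin n) ℂ)) *ᵥ Ψ) =
      homSum (concProfile α) ((M i * coeffMat Ψ)ᴴ * (M i * coeffMat Ψ)) := by
    rw [homConc, coeffMat_kronecker_mulVec, Matrix.transpose_one, Matrix.mul_one,
      homSum_mul_comm h0]
  have e' : homConc α Ψ =
      homSum (concProfile α) (∑ i, (M i * coeffMat Ψ)ᴴ * (M i * coeffMat Ψ)) := by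
    have : ∑ i, (M i * coeffMat Ψ)ᴴ * (M i * coeffMat Ψ) = (coeffMat Ψ)ᴴ * coeffMat Ψ := by
      calc _ = (coeffMat Ψ)ᴴ * (∑ i, (M i)ᴴ * M i) * coeffMat Ψ := by
            simp only [Matrix.conjTranspose_mul, Matrix.mul_sum, Matrix.sum_mul, Matrix.mul_assoc]
        _ = _ := by rw [hM, Matrix.mul_one]
    rw [this, homConc, homSum_mul_comm h0]
  simp only [e, e']
  exact sum_homSum_le hg fun i => Matrix.posSemidef_conjTranspose_mul_self _

/-- The total concurrence of a vector does not increase on average under a measurement of the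
second party. -/
theorem sum_homConc_right_le {α : ℝ} (hα₀ : 0 ≤ α) (hα₁ : α ≤ 1 / 2) {ι : Type*} [Fintype ι]
    {b : ι → ℕ} (M : ∀ i, Matrix (Fin (b i)) (Fin n) ℂ) (hM : ∑ i, (M i)ᴴ * M i = 1)
    (Ψ : Fin m × Fin n → ℂ) :
    ∑ i, homConc α (((1 : Matrix (Fin m) (Fin m) ℂ) ⊗ₖ M i) *ᵥ Ψ) ≤ homConc α Ψ := by
  have hg := concaveOn_concProfile hα₀ (hα₁.trans (by norm_num))
  have hM' : ∑ i, (M i)ᵀ * ((M i)ᵀ)ᴴ = 1 := by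
    rw [← Matrix.transpose_one, ← hM, Matrix.transpose_sum]
    refine Finset.sum_congr rfl fun i _ => ?_
    rw [Matrix.transpose_mul]
    rfl
  -- The second party acts on the right of `C`, so `C Cᴴ` itself splits and no exchange of factors
  -- is needed.
  have e' : coeffMat Ψ * (coeffMat Ψ)ᴴ =
      ∑ i, (coeffMat Ψ * (M i)ᵀ) * (coeffMat Ψ * (M i)ᵀ)ᴴ := by
    calc _ = coeffMat Ψ * (∑ i, (M i)ᵀ * ((M i)ᵀ)ᴴ) * (coeffMat Ψ)ᴴ := by
          rw [hM', Matrix.mul_one]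
      _ = _ := by
          simp only [Matrix.conjTranspose_mul, Matrix.mul_sum, Matrix.sum_mul, Matrix.mul_assoc]
  simp only [homConc, coeffMat_kronecker_mulVec, Matrix.one_mul]
  rw [e']
  exact sum_homSum_le hg fun i => Matrix.posSemidef_self_mul_conjTranspose _

theorem homConc_local_unitary (α : ℝ) {U : Matrix (Fin m) (Fin m) ℂ} (hU : Uᴴ * U = 1)
    {V : Matrix (Fin n) (Fin n) ℂ} (hV : Vᴴ * V = 1) (Ψ : Fin m × Fin n → ℂ) :
    homConc α ((U ⊗ₖ V) *ᵥ Ψ) = homConc α Ψ := by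
  have hV' : Vᵀ * (Vᵀ)ᴴ = 1 := by
    rw [← Matrix.transpose_one, ← hV, Matrix.transpose_mul]
    rfl
  have hU' : Uᴴ * (Uᴴ)ᴴ = 1 := by rwa [Matrix.conjTranspose_conjTranspose]
  rw [homConc, homConc, coeffMat_kronecker_mulVec, ← homSum_unitary_conj _ hU' (coeffMat Ψ * _),
    Matrix.conjTranspose_conjTranspose]
  congr 1
  calc _ = U * coeffMat Ψ * (Vᵀ * (Vᵀ)ᴴ) * (coeffMat Ψ)ᴴ * Uᴴ := by
        simp only [Matrix.conjTranspose_mul, Matrix.mul_assoc]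
    _ = _ := by rw [hV', Matrix.mul_one]; simp only [Matrix.mul_assoc]

/-- Here `C` has rank at most one, so `C Cᴴ` is zero or normalises to a projection, and the profile
vanishes at `0` and `1`. -/
theorem homConc_product (α : ℝ) (u : Fin m → ℂ) (v : Fin n → ℂ) :
    homConc α (fun i => u i.1 * v i.2) = 0 := by
  set Ψ : Fin m × Fin n → ℂ := fun i => u i.1 * v i.2 with hΨ
  have hC : coeffMat Ψ = Matrix.vecMulVec u v := by
    ext a b
    simp [coeffMat, hΨ, Matrix.vecMulVec_apply]
  set A := coeffMat Ψ * (coeffMat Ψ)ᴴ with hA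
  have hpsd : A.PosSemidef := Matrix.posSemidef_self_mul_conjTranspose _
  have hA1 : A = (v ⬝ᵥ star v) • Matrix.vecMulVec u (star u) := by
    rw [hA, hC, Matrix.conjTranspose_vecMulVec, Matrix.vecMulVec_mul_vecMulVec]
    ext; simp [Matrix.vecMulVec_apply]
    ring
  have htr : A.trace = (v ⬝ᵥ star v) * (u ⬝ᵥ star u) := by
    rw [hA1, Matrix.trace_smul, Matrix.trace_vecMulVec, smul_eq_mul]
  have hAA : A * A = A.trace • A := by
    rw [htr, hA1, Matrix.smul_mul, Matrix.mul_smul, Matrix.vecMulVec_mul_vecMulVec]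
    ext
    simp [Matrix.vecMulVec_apply, dotProduct_comm (star u) u]
    ring
  change homSum (concProfile α) A = 0
  rw [homSum, ofReal_trace_re hpsd]
  rcases eq_or_ne A.trace 0 with h | h
  · simp [h]
  · rw [spectralSum_concProfile_eq_zero, mul_zero]
    · exact ofReal_trace_re hpsd ▸ (posSemidef_inv_smul hpsd).isHermitian
    · rw [Matrix.smul_mul, Matrix.mul_smul, hAA, smul_smul _ _ A, inv_mul_cancel₀ h, one_smul]

end Pure

/-! ### The homogeneous convex roof is sublinear. -/

/-- The sums of the homogeneous total concurrence over all decompositions of `X` into rank-one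
operators. -/
def homRoof {m n : ℕ} (α : ℝ) (X : BiMat m n) : Set ℝ :=
  {x | ∃ (k : ℕ) (Ψ : Fin k → Fin m × Fin n → ℂ),
    X = ∑ i, proj (Ψ i) ∧ x = ∑ i, homConc α (Ψ i)}

/-- The homogeneous convex roof, defined on all positive semidefinite operators. -/
noncomputable def roofInf {m n : ℕ} (α : ℝ) (X : BiMat m n) : ℝ := sInf (homRoof α X)

section Roof

variable {m n : ℕ} {α : ℝ}

theorem sum_mem_homRoof {τ : Type*} [Fintype τ] (Ψ : τ → Fin m × Fin n → ℂ) :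
    ∑ i, homConc α (Ψ i) ∈ homRoof α (∑ i, proj (Ψ i)) :=
  ⟨Fintype.card τ, Ψ ∘ (Fintype.equivFin τ).symm,
    ((Fintype.equivFin τ).symm.sum_comp fun i => proj (Ψ i)).symm,
    ((Fintype.equivFin τ).symm.sum_comp fun i => homConc α (Ψ i)).symm⟩

theorem homRoof_nonempty {X : BiMat m n} (hX : X.PosSemidef) : (homRoof α X).Nonempty := by
  obtain ⟨k, v, rfl⟩ := Matrix.posSemidef_iff_eq_sum_vecMulVec.1 hX
  exact ⟨_, sum_mem_homRoof v⟩

theorem nonneg_of_mem_homRoof (hα₁ : α ≤ 1 / 2) {X : BiMat m n} {x : ℝ} (hx : x ∈ homRoof α X) :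
    0 ≤ x := by
  obtain ⟨k, Ψ, -, rfl⟩ := hx
  exact Finset.sum_nonneg fun i _ => homConc_nonneg hα₁ _

theorem bddBelow_homRoof (hα₁ : α ≤ 1 / 2) (X : BiMat m n) : BddBelow (homRoof α X) :=
  ⟨0, fun _ hx => nonneg_of_mem_homRoof hα₁ hx⟩

theorem roofInf_nonneg (hα₁ : α ≤ 1 / 2) (X : BiMat m n) : 0 ≤ roofInf α X :=
  Real.sInf_nonneg fun _ hx => nonneg_of_mem_homRoof hα₁ hx

theorem roofInf_sum_proj_le (hα₁ : α ≤ 1 / 2) {τ : Type*} [Fintype τ]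
    (Ψ : τ → Fin m × Fin n → ℂ) :
    roofInf α (∑ i, proj (Ψ i)) ≤ ∑ i, homConc α (Ψ i) :=
  csInf_le (bddBelow_homRoof hα₁ _) (sum_mem_homRoof Ψ)

theorem le_roofInf {X : BiMat m n} (hX : X.PosSemidef) {c : ℝ}
    (h : ∀ (k : ℕ) (Ψ : Fin k → Fin m × Fin n → ℂ), X = ∑ i, proj (Ψ i) →
      c ≤ ∑ i, homConc α (Ψ i)) : c ≤ roofInf α X := by
  refine le_csInf (homRoof_nonempty hX) ?_
  rintro _ ⟨k, Ψ, hk, rfl⟩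
  exact h k Ψ hk

theorem roofInf_zero (hα₁ : α ≤ 1 / 2) : roofInf α (0 : BiMat m n) = 0 := by
  refine le_antisymm ?_ (roofInf_nonneg hα₁ _)
  simpa using roofInf_sum_proj_le hα₁ (fun i : Empty => (i.elim : Fin m × Fin n → ℂ))

/-- Concatenating decompositions of `X` and `Y` decomposes `X + Y`. -/
theorem roofInf_add_le (hα₁ : α ≤ 1 / 2) {X Y : BiMat m n} (hX : X.PosSemidef)
    (hY : Y.PosSemidef) : roofInf α (X + Y) ≤ roofInf α X + roofInf α Y := by
  rw [← sub_le_iff_le_add]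
  refine le_roofInf hX fun k Ψ hΨ => ?_
  rw [sub_le_comm]
  refine le_roofInf hY fun l Θ hΘ => ?_
  have := roofInf_sum_proj_le hα₁ (Sum.elim Ψ Θ)
  rw [Fintype.sum_sum_type, Fintype.sum_sum_type] at this
  simp only [Sum.elim_inl, Sum.elim_inr, ← hΨ, ← hΘ] at this
  linarith

theorem roofInf_sum_le (hα₁ : α ≤ 1 / 2) {τ : Type*} (s : Finset τ) {X : τ → BiMat m n}
    (hX : ∀ i, (X i).PosSemidef) : roofInf α (∑ i ∈ s, X i) ≤ ∑ i ∈ s, roofInf α (X i) := by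
  classical
  induction s using Finset.induction_on with
  | empty => simp [roofInf_zero hα₁]
  | insert a s ha ih =>
    rw [Finset.sum_insert ha, Finset.sum_insert ha]
    exact (roofInf_add_le hα₁ (hX a) (Matrix.posSemidef_sum _ fun i _ => hX i)).trans
      (by gcongr)

theorem posSemidef_smul {ι : Type*} {A : Matrix ι ι ℂ} (hA : A.PosSemidef) {c : ℝ} (hc : 0 ≤ c) :
    ((c : ℂ) • A).PosSemidef :=
  hA.smul (Complex.zero_le_real.2 hc)

/-- Scale every vector of a decomposition by `√c`. For `c > 0` the reverse bound is this one with
`c⁻¹`. -/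
theorem roofInf_smul_le (hα₁ : α ≤ 1 / 2) {X : BiMat m n} (hX : X.PosSemidef) {c : ℝ}
    (hc : 0 ≤ c) : roofInf α ((c : ℂ) • X) ≤ c * roofInf α X := by
  rcases hc.eq_or_lt with rfl | h
  · simp [roofInf_zero hα₁]
  · rw [← div_le_iff₀' h]
    refine le_roofInf hX fun k Ψ hΨ => ?_
    rw [div_le_iff₀' h, hΨ]
    simpa only [proj_sqrt_smul hc, homConc_sqrt_smul α hc, ← Finset.smul_sum, ← Finset.mul_sum]
      using roofInf_sum_proj_le hα₁ fun i => (√c : ℂ) • Ψ i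

/-- Weights are absorbed as `√p`; conversely the squared norms are the weights, summing to one
because `ρ` has trace one. -/
theorem roofValues_eq_homRoof {ρ : BiMat m n} (hρ : IsState ρ) :
    roofValues (pureConc α) ρ = homRoof α ρ := by
  ext x
  constructor
  · rintro ⟨k, p, Φ, hp, -, hΦ, rfl, rfl⟩
    refine ⟨k, fun i => (√(p i) : ℂ) • Φ i, ?_, ?_⟩
    · exact Finset.sum_congr rfl fun i _ => (proj_sqrt_smul (hp i) _).symm
    · exact Finset.sum_congr rfl fun i _ => by
        rw [homConc_sqrt_smul α (hp i), pureConc_eq_homConc α (hΦ i)]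
  · rintro ⟨k, Ψ, rfl, rfl⟩
    have : Nonempty (Fin m × Fin n) := by
      by_contra h
      rw [not_nonempty_iff] at h
      have := hρ.2
      simp [Matrix.trace] at this
    choose Φ hΦ hΨ using fun i => exists_unit_smul (Ψ i) (Classical.arbitrary _)
    have hN (i : Fin k) : 0 ≤ ∑ j, ‖Ψ i j‖ ^ 2 := Finset.sum_nonneg fun _ _ => sq_nonneg _
    refine ⟨k, fun i => ∑ j, ‖Ψ i j‖ ^ 2, Φ, hN, ?_, hΦ, ?_, ?_⟩
    · have := hρ.2
      simp only [Matrix.trace_sum, trace_proj] at this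
      exact_mod_cast this
    · refine Finset.sum_congr rfl fun i _ => ?_
      conv_lhs => rw [hΨ i]
      rw [proj_sqrt_smul (hN i)]
    · refine Finset.sum_congr rfl fun i _ => ?_
      conv_lhs => rw [hΨ i]
      rw [homConc_sqrt_smul α (hN i), pureConc_eq_homConc α (hΦ i)]

theorem mixedConc_eq_roofInf {ρ : BiMat m n} (hρ : IsState ρ) :
    mixedConc α m n ρ = roofInf α ρ := by
  rw [mixedConc, roofValues_eq_homRoof hρ, roofInf]

theorem posSemidef_conj {ι κ : Type*} [Fintype ι] [Fintype κ] {X : Matrix ι ι ℂ}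
    (hX : X.PosSemidef) (K : Matrix κ ι ℂ) : (K * X * Kᴴ).PosSemidef :=
  hX.mul_mul_conjTranspose_same K

/-- A family of operators that does not increase the total concurrence of vectors on average does
not increase the convex roof on average. -/
theorem sum_roofInf_le (hα₁ : α ≤ 1 / 2) {τ : Type*} [Fintype τ] {a b : τ → ℕ}
    (L : ∀ i, Matrix (Fin (a i) × Fin (b i)) (Fin m × Fin n) ℂ)
    (hL : ∀ Ψ, ∑ i, homConc α (L i *ᵥ Ψ) ≤ homConc α Ψ) {X : BiMat m n} (hX : X.PosSemidef) :
    ∑ i, roofInf α (L i * X * (L i)ᴴ) ≤ roofInf α X := by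
  -- Each `L i` carries a decomposition of `X` to one of `L i * X * (L i)ᴴ`.
  refine le_roofInf hX fun k Ψ hΨ => ?_
  calc ∑ i, roofInf α (L i * X * (L i)ᴴ)
      ≤ ∑ i, ∑ j, homConc α (L i *ᵥ Ψ j) := Finset.sum_le_sum fun i _ => by
        have := roofInf_sum_proj_le hα₁ fun j => L i *ᵥ Ψ j
        simpa only [proj_mulVec, ← Matrix.sum_mul, ← Matrix.mul_sum, ← hΨ] using this
    _ = ∑ j, ∑ i, homConc α (L i *ᵥ Ψ j) := Finset.sum_comm
    _ ≤ ∑ j, homConc α (Ψ j) := Finset.sum_le_sum fun j _ => hL (Ψ j)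

end Roof

/-! ### Induction on LOCC protocols. -/

/-- A sum over a sigma type, with an arbitrary enumeration of the sigma type. -/
theorem sum_sigma_eq {ι : Type} [Fintype ι] {κ : ι → Type} [Fintype (Σ i, κ i)]
    [∀ i, Fintype (κ i)] {M : Type*} [AddCommMonoid M] (f : (Σ i, κ i) → M) :
    ∑ x, f x = ∑ i, ∑ j, f ⟨i, j⟩ := by
  rw [← Fintype.sum_sigma f]
  congr!

/-- A protocol carries no finiteness of its later records; each branch inherits it from the whole.
-/
theorem finite_sigma_fiber {ι : Type} {κ : ι → Type} [Fintype (Σ i, κ i)] (i : ι) :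
    Finite (κ i) :=
  Finite.of_injective (Sigma.mk i) sigma_mk_injective

/-- The homogeneous convex roof does not increase on average under LOCC. -/
theorem IsLOCC.sum_roofInf_le {α : ℝ} (hα₀ : 0 ≤ α) (hα₁ : α ≤ 1 / 2) {m n m' n' : ℕ} {κ : Type}
    {K : κ → Matrix (Fin m' × Fin n') (Fin m × Fin n) ℂ} (hK : IsLOCC m' n' m n κ K) :
    ∀ [Fintype κ] {X : BiMat m n}, X.PosSemidef →
      ∑ i, roofInf α (K i * X * (K i)ᴴ) ≤ roofInf α X := by
  induction hK with
  | done => intro _ X _; simp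
  | alice m n ι a M hM κ K hK ih =>
    intro _ X hX
    have hfin (i : ι) : Fintype (κ i) := @Fintype.ofFinite _ (finite_sigma_fiber i)
    rw [sum_sigma_eq]
    -- The induction hypothesis handles the continuation after each outcome, the local bound the
    -- first measurement.
    refine le_trans (Finset.sum_le_sum fun i _ => ?_)
      (TotalConcurrence.sum_roofInf_le hα₁ _ (sum_homConc_left_le hα₀ hα₁ M hM) hX)
    refine le_of_eq_of_le ?_ (ih i (posSemidef_conj hX _))
    simp only [Matrix.conjTranspose_mul, Matrix.mul_assoc]
  | bob m n ι b M hM κ K hK ih =>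
    intro _ X hX
    have hfin (i : ι) : Fintype (κ i) := @Fintype.ofFinite _ (finite_sigma_fiber i)
    rw [sum_sigma_eq]
    refine le_trans (Finset.sum_le_sum fun i _ => ?_)
      (TotalConcurrence.sum_roofInf_le hα₁ _ (sum_homConc_right_le hα₀ hα₁ M hM) hX)
    refine le_of_eq_of_le ?_ (ih i (posSemidef_conj hX _))
    simp only [Matrix.conjTranspose_mul, Matrix.mul_assoc]

theorem sum_conjTranspose_mul_comp {ι κ μ τ : Type*} [Fintype ι] [Fintype κ] [DecidableEq κ]
    [Fintype μ] [Fintype τ] (J : τ → Matrix μ κ ℂ) (N : Matrix κ ι ℂ)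
    (hJ : ∑ j, (J j)ᴴ * J j = 1) : ∑ j, (J j * N)ᴴ * (J j * N) = Nᴴ * N := by
  calc ∑ j, (J j * N)ᴴ * (J j * N) = Nᴴ * (∑ j, (J j)ᴴ * J j) * N := by
        rw [Matrix.mul_sum, Matrix.sum_mul]
        simp only [Matrix.conjTranspose_mul, Matrix.mul_assoc]
    _ = Nᴴ * N := by rw [hJ, Matrix.mul_one]

/-- The Kraus operators of an LOCC protocol are complete. -/
theorem IsLOCC.sum_conjTranspose_mul {m n m' n' : ℕ} {κ : Type}
    {K : κ → Matrix (Fin m' × Fin n') (Fin m × Fin n) ℂ} (hK : IsLOCC m' n' m n κ K) :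
    ∀ [Fintype κ], ∑ i, (K i)ᴴ * K i = 1 := by
  induction hK with
  | done => intro _; simp
  | alice m n ι a M hM κ K hK ih =>
    intro _
    have hfin (i : ι) : Fintype (κ i) := @Fintype.ofFinite _ (finite_sigma_fiber i)
    have h (i : ι) := sum_conjTranspose_mul_comp (K i)
      (M i ⊗ₖ (1 : Matrix (Fin n) (Fin n) ℂ)) (ih i)
    rw [sum_sigma_eq]
    simp only [h, Matrix.conjTranspose_kronecker, Matrix.conjTranspose_one]
    rw [Finset.sum_congr rfl fun i _ => (Matrix.mul_kronecker_mul _ _ _ _).symm,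
      ← Matrix.one_kronecker_one, ← hM]
    ext
    simp [Matrix.sum_apply, Finset.sum_mul]
  | bob m n ι b M hM κ K hK ih =>
    intro _
    have hfin (i : ι) : Fintype (κ i) := @Fintype.ofFinite _ (finite_sigma_fiber i)
    have h (i : ι) := sum_conjTranspose_mul_comp (K i)
      ((1 : Matrix (Fin m) (Fin m) ℂ) ⊗ₖ M i) (ih i)
    rw [sum_sigma_eq]
    simp only [h, Matrix.conjTranspose_kronecker, Matrix.conjTranspose_one]
    rw [Finset.sum_congr rfl fun i _ => (Matrix.mul_kronecker_mul _ _ _ _).symm,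
      ← Matrix.one_kronecker_one, ← hM]
    ext
    simp [Matrix.sum_apply, Finset.mul_sum]

/-! ### Minors, linear entropy and faithfulness. -/

/-- Half the sum of the squared moduli of the `2 × 2` minors of the coefficient matrix. -/
noncomputable def minorSum {m n : ℕ} (Ψ : Fin m × Fin n → ℂ) : ℝ :=
  (∑ a, ∑ a', ∑ b, ∑ b', ‖Ψ (a, b) * Ψ (a', b') - Ψ (a, b') * Ψ (a', b)‖ ^ 2) / 2

section Minors

variable {m n : ℕ}

theorem minorSum_nonneg (Ψ : Fin m × Fin n → ℂ) : 0 ≤ minorSum Ψ := by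
  unfold minorSum
  positivity

theorem continuous_minorSum : Continuous (minorSum : (Fin m × Fin n → ℂ) → ℝ) := by
  unfold minorSum
  fun_prop

/-- Lagrange's identity: on unit vectors the minors compute the linear entropy `1 - tr ρ_A ^ 2`. -/
theorem minorSum_eq (Ψ : Fin m × Fin n → ℂ) :
    (minorSum Ψ : ℂ) = (coeffMat Ψ * (coeffMat Ψ)ᴴ).trace ^ 2 -
      (coeffMat Ψ * (coeffMat Ψ)ᴴ * (coeffMat Ψ * (coeffMat Ψ)ᴴ)).trace := by
  -- Half of the expanded squared modulus; the other half is `G` with `b` and `b'` exchanged.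
  let G : Fin m → Fin m → Fin n → Fin n → ℂ := fun a a' b b' =>
    Ψ (a, b) * Ψ (a', b') * (star (Ψ (a, b)) * star (Ψ (a', b')) -
      star (Ψ (a, b')) * star (Ψ (a', b)))
  have hG (a a' : Fin m) (b b' : Fin n) :
      ((‖Ψ (a, b) * Ψ (a', b') - Ψ (a, b') * Ψ (a', b)‖ ^ 2 : ℝ) : ℂ) =
        G a a' b b' + G a a' b' b := by
    rw [← Complex.normSq_eq_norm_sq, ← Complex.mul_conj]
    simp only [G, map_sub, map_mul, RCLike.star_def]
    ring
  have h1 : (minorSum Ψ : ℂ) = ∑ a, ∑ a', ∑ b, ∑ b', G a a' b b' := by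
    have h2 (a a' : Fin m) : ∑ b, ∑ b', (G a a' b b' + G a a' b' b) =
        2 * ∑ b, ∑ b', G a a' b b' := by
      simp only [Finset.sum_add_distrib]
      rw [two_mul]
      congr 1
      exact Finset.sum_comm
    unfold minorSum
    rw [Complex.ofReal_div]
    simp only [Complex.ofReal_sum, hG, h2, ← Finset.mul_sum]
    norm_num
  have h2 : (coeffMat Ψ * (coeffMat Ψ)ᴴ).trace ^ 2 =
      ∑ a, ∑ a', ∑ b, ∑ b', Ψ (a, b) * Ψ (a', b') * (star (Ψ (a, b)) * star (Ψ (a', b'))) := by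
    simp only [Matrix.trace, Matrix.diag_apply, Matrix.mul_apply, Matrix.conjTranspose_apply,
      coeffMat, Matrix.of_apply]
    rw [pow_two, Finset.sum_mul_sum]
    refine Finset.sum_congr rfl fun a _ => Finset.sum_congr rfl fun a' _ => ?_
    rw [Finset.sum_mul_sum]
    exact Finset.sum_congr rfl fun b _ => Finset.sum_congr rfl fun b' _ => by ring
  have h3 : (coeffMat Ψ * (coeffMat Ψ)ᴴ * (coeffMat Ψ * (coeffMat Ψ)ᴴ)).trace =
      ∑ a, ∑ a', ∑ b, ∑ b', Ψ (a, b) * Ψ (a', b') * (star (Ψ (a, b')) * star (Ψ (a', b))) := by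
    simp only [Matrix.trace, Matrix.diag_apply, Matrix.mul_apply, Matrix.conjTranspose_apply,
      coeffMat, Matrix.of_apply]
    refine Finset.sum_congr rfl fun a _ => Finset.sum_congr rfl fun a' _ => ?_
    rw [Finset.sum_mul_sum]
    exact Finset.sum_congr rfl fun b _ => Finset.sum_congr rfl fun b' _ => by ring
  rw [h1, h2, h3]
  simp only [← Finset.sum_sub_distrib, G, mul_sub]

theorem minorSum_le_pureConc {α : ℝ} (hα₁ : α ≤ 1 / 2) {Φ : Fin m × Fin n → ℂ}
    (hΦ : IsUnitVec Φ) : minorSum Φ ≤ pureConc α Φ := by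
  have ht : (coeffMat Φ * (coeffMat Φ)ᴴ).trace = 1 := by
    rw [trace_coeffMat_mul, hΦ, Complex.ofReal_one]
  have hpsd := Matrix.posSemidef_self_mul_conjTranspose (coeffMat Φ)
  have h := congrArg Complex.re (minorSum_eq Φ)
  rw [Complex.ofReal_re, ht, one_pow, Complex.sub_re, Complex.one_re] at h
  rw [h, pureConc, partialTraceB_proj, totalConc_eq_spectralSum α hpsd.isHermitian ht]
  exact one_sub_trace_sq_le hα₁ hpsd ht

theorem proj_product (u : Fin m → ℂ) (v : Fin n → ℂ) :
    proj (fun i : Fin m × Fin n => u i.1 * v i.2) = proj u ⊗ₖ proj v := by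
  ext i j
  simp only [proj, Matrix.vecMulVec_apply, Matrix.kroneckerMap_apply, Pi.star_apply, star_mul']
  ring

theorem isState_proj {ι : Type*} [Fintype ι] {ψ : ι → ℂ} (hψ : IsUnitVec ψ) :
    IsState (proj ψ) :=
  ⟨posSemidef_proj ψ, by rw [trace_proj, hψ, Complex.ofReal_one]⟩

theorem isState_inv_smul {ι : Type*} [Fintype ι] {A : Matrix ι ι ℂ} (hA : A.PosSemidef)
    (h : A.trace.re ≠ 0) : IsState ((A.trace.re⁻¹ : ℂ) • A) := by
  refine ⟨posSemidef_inv_smul hA, ?_⟩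
  rw [Matrix.trace_smul, smul_eq_mul, ← ofReal_trace_re hA]
  exact inv_mul_cancel₀ (by exact_mod_cast h)

theorem exists_product_of_minorSum_eq_zero {Φ : Fin m × Fin n → ℂ} (hΦ : IsUnitVec Φ)
    (h : minorSum Φ = 0) : ∃ (σ : Matrix (Fin m) (Fin m) ℂ) (τ : Matrix (Fin n) (Fin n) ℂ),
      IsState σ ∧ IsState τ ∧ proj Φ = σ ⊗ₖ τ := by
  have hmin (a a' : Fin m) (b b' : Fin n) :
      Φ (a, b) * Φ (a', b') = Φ (a, b') * Φ (a', b) := by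
    have h0 : ∑ a, ∑ a', ∑ b, ∑ b', ‖Φ (a, b) * Φ (a', b') - Φ (a, b') * Φ (a', b)‖ ^ 2 = 0 := by
      unfold minorSum at h
      linarith
    have h1 := (Finset.sum_eq_zero_iff_of_nonneg fun i _ => by positivity).1 h0 a
      (Finset.mem_univ _)
    have h2 := (Finset.sum_eq_zero_iff_of_nonneg fun i _ => by positivity).1 h1 a'
      (Finset.mem_univ _)
    have h3 := (Finset.sum_eq_zero_iff_of_nonneg fun i _ => by positivity).1 h2 b
      (Finset.mem_univ _)
    have h4 := (Finset.sum_eq_zero_iff_of_nonneg fun i _ => by positivity).1 h3 b'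
      (Finset.mem_univ _)
    exact sub_eq_zero.1 (norm_eq_zero.1 (pow_eq_zero_iff two_ne_zero |>.1 h4))
  obtain ⟨⟨a₀, b₀⟩, h₀⟩ : ∃ i, Φ i ≠ 0 := by
    by_contra! hc
    simp [IsUnitVec, hc] at hΦ
  -- Vanishing minors make `C` the pivot column times the pivot row divided by the pivot.
  let u : Fin m → ℂ := fun a => Φ (a, b₀)
  let v : Fin n → ℂ := fun b => Φ (a₀, b) / Φ (a₀, b₀)
  have hΦuv : Φ = fun i => u i.1 * v i.2 := by
    ext ⟨a, b⟩
    simp only [u, v]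
    rw [mul_div_assoc', eq_div_iff h₀, hmin]
  have hproj : proj Φ = proj u ⊗ₖ proj v := by
    conv_lhs => rw [hΦuv]
    exact proj_product u v
  -- The factors need not be normalised, but their traces multiply to one, so normalising both
  -- leaves the product unchanged.
  have htr : ((proj u).trace.re : ℂ) * ((proj v).trace.re : ℂ) = 1 := by
    rw [ofReal_trace_re (posSemidef_proj u), ofReal_trace_re (posSemidef_proj v),
      ← Matrix.trace_kronecker, ← hproj]
    exact (isState_proj hΦ).2
  have hu : (proj u).trace.re ≠ 0 := fun h => by simp [h] at htr
  have hv : (proj v).trace.re ≠ 0 := fun h => by simp [h] at htr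
  refine ⟨_, _, isState_inv_smul (posSemidef_proj u) hu, isState_inv_smul (posSemidef_proj v) hv,
    ?_⟩
  rw [Matrix.smul_kronecker, Matrix.kronecker_smul, smul_smul, ← mul_inv, htr, inv_one, one_smul,
    hproj]

theorem isCompact_isUnitVec {ι : Type*} [Fintype ι] : IsCompact {ψ : ι → ℂ | IsUnitVec ψ} := by
  refine (isCompact_closedBall (0 : ι → ℂ) 1).of_isClosed_subset ?_ fun ψ hψ => ?_
  · exact isClosed_eq (by fun_prop) continuous_const
  · rw [mem_closedBall_zero_iff, pi_norm_le_iff_of_nonneg zero_le_one]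
    intro i
    have : ‖ψ i‖ ^ 2 ≤ 1 := by
      rw [← show ∑ i, ‖ψ i‖ ^ 2 = 1 from hψ]
      exact Finset.single_le_sum (f := fun i => ‖ψ i‖ ^ 2) (fun _ _ => sq_nonneg _)
        (Finset.mem_univ i)
    exact (sq_le_one_iff₀ (norm_nonneg _)).1 this

theorem isSeparable_of_fintype {ι : Type*} [Fintype ι] {p : ι → ℝ}
    {σ : ι → Matrix (Fin m) (Fin m) ℂ} {τ : ι → Matrix (Fin n) (Fin n) ℂ}
    (hp : ∀ i, 0 ≤ p i) (hp₁ : ∑ i, p i = 1) (hσ : ∀ i, IsState (σ i)) (hτ : ∀ i, IsState (τ i)) :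
    IsSeparable (∑ i, (p i : ℂ) • (σ i ⊗ₖ τ i)) := by
  let e := (Fintype.equivFin ι).symm
  exact ⟨Fintype.card ι, p ∘ e, σ ∘ e, τ ∘ e, fun i => hp _, (e.sum_comp p).trans hp₁,
    fun i => hσ _, fun i => hτ _, (e.sum_comp fun i => (p i : ℂ) • (σ i ⊗ₖ τ i)).symm⟩

theorem IsState.nonempty {ι : Type*} [Fintype ι] {ρ : Matrix ι ι ℂ} (hρ : IsState ρ) :
    Nonempty ι := by
  by_contra h
  rw [not_nonempty_iff] at h
  simpa [Matrix.trace] using hρ.2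

theorem exists_isState {d : ℕ} (i : Fin d) : ∃ σ : Matrix (Fin d) (Fin d) ℂ, IsState σ := by
  refine ⟨proj (Pi.single i 1), isState_proj ?_⟩
  rw [IsUnitVec, Finset.sum_eq_single i] <;> simp +contextual

/-- Near-optimal decompositions put `(ρ, y)` with `y → 0` in the convex hull of the compact graph of
`minorSum` over pure states. The hull is closed, so it contains `(ρ, 0)`, which is a decomposition
with zero average minor sum. -/
theorem isSeparable_of_mixedConc_eq_zero {α : ℝ} (hα₁ : α ≤ 1 / 2) {ρ : BiMat m n}
    (hρ : IsState ρ) (h : mixedConc α m n ρ = 0) : IsSeparable ρ := by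
  let F : (Fin m × Fin n → ℂ) → BiMat m n × ℝ := fun Φ => (proj Φ, minorSum Φ)
  have hF : Continuous F :=
    (Continuous.matrix_vecMulVec continuous_id continuous_star).prodMk continuous_minorSum
  have hcl : IsClosed (convexHull ℝ (F '' {Φ | IsUnitVec Φ})) :=
    (isCompact_convexHull (isCompact_isUnitVec.image hF)).isClosed
  have hne : (roofValues (pureConc α) ρ).Nonempty := by
    rw [roofValues_eq_homRoof hρ]
    exact homRoof_nonempty hρ.1
  have happ (k : ℕ) : ∃ y : ℝ, 0 ≤ y ∧ y ≤ 1 / ((k : ℝ) + 1) ∧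
      (ρ, y) ∈ convexHull ℝ (F '' {Φ | IsUnitVec Φ}) := by
    have hlt : sInf (roofValues (pureConc α) ρ) < 1 / ((k : ℝ) + 1) := by
      have : mixedConc α m n ρ < 1 / ((k : ℝ) + 1) := by rw [h]; positivity
      exact this
    obtain ⟨x, ⟨l, p, Φ, hp, hp₁, hΦ, hρΦ, rfl⟩, hx⟩ := exists_lt_of_csInf_lt hne hlt
    refine ⟨∑ i, p i * minorSum (Φ i),
      Finset.sum_nonneg fun i _ => mul_nonneg (hp i) (minorSum_nonneg _),
      le_trans (Finset.sum_le_sum fun i _ =>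
        mul_le_mul_of_nonneg_left (minorSum_le_pureConc hα₁ (hΦ i)) (hp i)) hx.le,
      mem_convexHull_of_exists_fintype p (fun i => F (Φ i)) hp hp₁
        (fun i => Set.mem_image_of_mem _ (hΦ i)) ?_⟩
    refine Prod.ext ?_ ?_
    · rw [Prod.fst_sum, hρΦ]
      rfl
    · rw [Prod.snd_sum]
      rfl
  choose y hy₀ hy₁ hy using happ
  have hlim : Filter.Tendsto (fun k => (ρ, y k)) Filter.atTop (nhds (ρ, (0 : ℝ))) :=
    tendsto_const_nhds.prodMk_nhds
      (squeeze_zero hy₀ hy₁ tendsto_one_div_add_atTop_nhds_zero_nat)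
  obtain ⟨ι, _, w, z, hw, hw₁, hz, hsum⟩ := mem_convexHull_iff_exists_fintype.1
    (hcl.mem_of_tendsto hlim (Filter.Eventually.of_forall hy))
  choose Φ hΦ hΦz using hz
  obtain rfl : (fun i => F (Φ i)) = z := funext hΦz
  have hρ' : ρ = ∑ i, (w i : ℂ) • proj (Φ i) := by
    have := congrArg Prod.fst hsum
    rw [Prod.fst_sum] at this
    exact this.symm
  have h0 : ∑ i, w i * minorSum (Φ i) = 0 := by
    have := congrArg Prod.snd hsum
    rw [Prod.snd_sum] at this
    exact this
  obtain ⟨⟨a₀, b₀⟩⟩ := hρ.nonempty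
  have key (i : ι) : ∃ (σ : Matrix (Fin m) (Fin m) ℂ) (τ : Matrix (Fin n) (Fin n) ℂ),
      IsState σ ∧ IsState τ ∧ (w i : ℂ) • proj (Φ i) = (w i : ℂ) • (σ ⊗ₖ τ) := by
    have hi := (Finset.sum_eq_zero_iff_of_nonneg fun i _ =>
      mul_nonneg (hw i) (minorSum_nonneg (Φ i))).1 h0 i (Finset.mem_univ i)
    -- A vector of weight zero may be entangled; an arbitrary product state replaces it.
    rcases mul_eq_zero.1 hi with hi | hi
    · obtain ⟨σ, hσ⟩ := exists_isState a₀
      obtain ⟨τ, hτ⟩ := exists_isState b₀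
      exact ⟨σ, τ, hσ, hτ, by simp [hi]⟩
    · obtain ⟨σ, τ, hσ, hτ, hστ⟩ := exists_product_of_minorSum_eq_zero (hΦ i) hi
      exact ⟨σ, τ, hσ, hτ, by rw [hστ]⟩
  choose σ τ hσ hτ hστ using key
  rw [hρ', Finset.sum_congr rfl fun i _ => hστ i]
  exact isSeparable_of_fintype hw hw₁ hσ hτ

/-- Decomposing both factors into rank-one operators decomposes the product into product vectors. -/
theorem roofInf_kronecker_le {α : ℝ} (hα₁ : α ≤ 1 / 2) {σ : Matrix (Fin m) (Fin m) ℂ}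
    {τ : Matrix (Fin n) (Fin n) ℂ} (hσ : σ.PosSemidef) (hτ : τ.PosSemidef) :
    roofInf α (σ ⊗ₖ τ) ≤ 0 := by
  obtain ⟨k, u, rfl⟩ := Matrix.posSemidef_iff_eq_sum_vecMulVec.1 hσ
  obtain ⟨l, v, rfl⟩ := Matrix.posSemidef_iff_eq_sum_vecMulVec.1 hτ
  have e : (∑ i, Matrix.vecMulVec (u i) (star (u i))) ⊗ₖ
      (∑ j, Matrix.vecMulVec (v j) (star (v j))) =
      ∑ q : Fin k × Fin l, proj fun i : Fin m × Fin n => u q.1 i.1 * v q.2 i.2 := by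
    simp only [proj_product, Fintype.sum_prod_type]
    ext i j
    simp only [Matrix.kroneckerMap_apply, Matrix.sum_apply, Finset.sum_mul_sum, proj]
  rw [e]
  exact (roofInf_sum_proj_le hα₁ _).trans_eq (Finset.sum_eq_zero fun _ _ => homConc_product _ _ _)

theorem mixedConc_eq_zero_of_isSeparable {α : ℝ} (hα₁ : α ≤ 1 / 2) {ρ : BiMat m n}
    (hρ : IsState ρ) (h : IsSeparable ρ) : mixedConc α m n ρ = 0 := by
  rw [mixedConc_eq_roofInf hρ]
  refine le_antisymm ?_ (roofInf_nonneg hα₁ ρ)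
  obtain ⟨k, p, σ, τ, hp, -, hσ, hτ, rfl⟩ := h
  have hpsd (i : Fin k) : (σ i ⊗ₖ τ i).PosSemidef := (hσ i).1.kronecker (hτ i).1
  refine (roofInf_sum_le hα₁ _ fun i => posSemidef_smul (hpsd i) (hp i)).trans
    (Finset.sum_nonpos fun i _ => (roofInf_smul_le hα₁ (hpsd i) (hp i)).trans ?_)
  exact mul_nonpos_of_nonneg_of_nonpos (hp i) (roofInf_kronecker_le hα₁ (hσ i).1 (hτ i).1)

end Minors

/-! ### Verification of the axioms. -/

section Measure

variable {m n m' n' : ℕ} {α : ℝ}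

theorem isState_sum_smul {ι κ : Type*} [Fintype ι] [Fintype κ] {p : κ → ℝ}
    {ρ : κ → Matrix ι ι ℂ} (hp : ∀ i, 0 ≤ p i) (hp₁ : ∑ i, p i = 1) (hρ : ∀ i, IsState (ρ i)) :
    IsState (∑ i, (p i : ℂ) • ρ i) := by
  refine ⟨Matrix.posSemidef_sum _ fun i _ => posSemidef_smul (hρ i).1 (hp i), ?_⟩
  simp only [Matrix.trace_sum, Matrix.trace_smul, (hρ _).2, smul_eq_mul, mul_one]
  exact_mod_cast hp₁

theorem isState_sum_conj {ι κ μ : Type*} [Fintype ι] [DecidableEq ι] [Fintype κ] [Fintype μ]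
    {K : κ → Matrix μ ι ℂ} (hK : ∑ i, (K i)ᴴ * K i = 1) {ρ : Matrix ι ι ℂ} (hρ : IsState ρ) :
    IsState (∑ i, K i * ρ * (K i)ᴴ) := by
  refine ⟨Matrix.posSemidef_sum _ fun i _ => posSemidef_conj hρ.1 (K i), ?_⟩
  have (i : κ) : (K i * ρ * (K i)ᴴ).trace = ((K i)ᴴ * K i * ρ).trace := by
    rw [Matrix.trace_mul_comm, Matrix.mul_assoc]
  rw [Matrix.trace_sum]
  simp only [this]
  rw [← Matrix.trace_sum, ← Matrix.sum_mul, hK, Matrix.one_mul, hρ.2]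

/-- Homogeneity trades the normalised outcome weighted by its probability for the unnormalised one;
at probability zero the left side is `0`. -/
theorem mul_mixedConc_inv_smul_le (hα₁ : α ≤ 1 / 2) {X : BiMat m n} (hX : X.PosSemidef) :
    X.trace.re * mixedConc α m n ((X.trace.re⁻¹ : ℂ) • X) ≤ roofInf α X := by
  rcases eq_or_ne X.trace.re 0 with h | h
  · rw [h, zero_mul]
    exact roofInf_nonneg hα₁ X
  · have hpos : 0 < X.trace.re := lt_of_le_of_ne (trace_re_nonneg hX) h.symm
    rw [mixedConc_eq_roofInf (isState_inv_smul hX h)]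
    have := roofInf_smul_le hα₁ hX (inv_nonneg.2 hpos.le)
    rw [Complex.ofReal_inv] at this
    exact (le_inv_mul_iff₀ hpos).1 this

/-- A local unitary is a one-outcome family preserving the concurrence of vectors. Equality later
follows by applying this to the inverse. -/
theorem mixedConc_local_unitary_le (hα₁ : α ≤ 1 / 2) {ρ : BiMat m n} (hρ : IsState ρ)
    {U : Matrix (Fin m) (Fin m) ℂ} (hU : Uᴴ * U = 1) {V : Matrix (Fin n) (Fin n) ℂ}
    (hV : Vᴴ * V = 1) :
    IsState ((U ⊗ₖ V) * ρ * (Uᴴ ⊗ₖ Vᴴ)) ∧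
      mixedConc α m n ((U ⊗ₖ V) * ρ * (Uᴴ ⊗ₖ Vᴴ)) ≤ mixedConc α m n ρ := by
  rw [← Matrix.conjTranspose_kronecker]
  have hUV : (U ⊗ₖ V)ᴴ * (U ⊗ₖ V) = 1 := by
    rw [Matrix.conjTranspose_kronecker, ← Matrix.mul_kronecker_mul, hU, hV,
      Matrix.one_kronecker_one]
  have hst : IsState ((U ⊗ₖ V) * ρ * (U ⊗ₖ V)ᴴ) := by
    simpa using isState_sum_conj (K := fun _ : Unit => U ⊗ₖ V) (by simpa using hUV) hρ
  refine ⟨hst, ?_⟩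
  rw [mixedConc_eq_roofInf hst, mixedConc_eq_roofInf hρ]
  simpa using sum_roofInf_le hα₁ (fun _ : Unit => U ⊗ₖ V)
    (fun Ψ => by simpa using (homConc_local_unitary α hU hV Ψ).le) hρ.1

theorem isEntanglementMeasure_mixedConc (hα₀ : 0 ≤ α) (hα₁ : α ≤ 1 / 2) :
    IsEntanglementMeasure (mixedConc α) where
  nonneg m n ρ hρ := by
    rw [mixedConc_eq_roofInf hρ]
    exact roofInf_nonneg hα₁ ρ
  eq_zero_iff m n ρ hρ :=
    ⟨isSeparable_of_mixedConc_eq_zero hα₁ hρ, mixedConc_eq_zero_of_isSeparable hα₁ hρ⟩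
  local_unitary m n ρ hρ U hU V hV := by
    have hU₁ : Uᴴ * U = 1 := Matrix.mem_unitaryGroup_iff'.1 hU
    have hV₁ : Vᴴ * V = 1 := Matrix.mem_unitaryGroup_iff'.1 hV
    have hU₂ : (Uᴴ)ᴴ * Uᴴ = 1 := by
      rw [Matrix.conjTranspose_conjTranspose]; exact Matrix.mem_unitaryGroup_iff.1 hU
    have hV₂ : (Vᴴ)ᴴ * Vᴴ = 1 := by
      rw [Matrix.conjTranspose_conjTranspose]; exact Matrix.mem_unitaryGroup_iff.1 hV
    obtain ⟨hst, hle⟩ := mixedConc_local_unitary_le hα₁ hρ hU₁ hV₁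
    refine le_antisymm hle ?_
    have h := (mixedConc_local_unitary_le hα₁ hst hU₂ hV₂).2
    have e : (Uᴴ ⊗ₖ Vᴴ) * ((U ⊗ₖ V) * ρ * (Uᴴ ⊗ₖ Vᴴ)) * ((Uᴴ)ᴴ ⊗ₖ (Vᴴ)ᴴ) = ρ := by
      have hl : (Uᴴ ⊗ₖ Vᴴ) * (U ⊗ₖ V) = 1 := by
        rw [← Matrix.mul_kronecker_mul, hU₁, hV₁, Matrix.one_kronecker_one]
      rw [Matrix.conjTranspose_conjTranspose, Matrix.conjTranspose_conjTranspose]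
      calc _ = (Uᴴ ⊗ₖ Vᴴ) * (U ⊗ₖ V) * ρ * ((Uᴴ ⊗ₖ Vᴴ) * (U ⊗ₖ V)) := by
            simp only [Matrix.mul_assoc]
        _ = ρ := by rw [hl, Matrix.one_mul, Matrix.mul_one]
    rwa [e] at h
  locc_average m n m' n' ρ hρ κ _ K hK p hp := by
    rw [mixedConc_eq_roofInf hρ]
    refine le_trans (Finset.sum_le_sum fun i _ => ?_) (hK.sum_roofInf_le hα₀ hα₁ hρ.1)
    rw [hp i]
    exact mul_mixedConc_inv_smul_le hα₁ (posSemidef_conj hρ.1 (K i))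
  convex m n k p ρ hp hp₁ hρ := by
    rw [mixedConc_eq_roofInf (isState_sum_smul hp hp₁ hρ)]
    refine (roofInf_sum_le hα₁ _ fun i => posSemidef_smul (hρ i).1 (hp i)).trans
      (Finset.sum_le_sum fun i _ => ?_)
    rw [mixedConc_eq_roofInf (hρ i)]
    exact roofInf_smul_le hα₁ (hρ i).1 (hp i)
  locc_map m n m' n' ρ hρ Λ hΛ := by
    obtain ⟨κ, _, K, hK, hΛK⟩ := hΛ
    rw [hΛK, mixedConc_eq_roofInf (isState_sum_conj hK.sum_conjTranspose_mul hρ),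
      mixedConc_eq_roofInf hρ]
    -- Forgetting the outcomes costs only subadditivity, after which the average bound applies.
    exact (roofInf_sum_le hα₁ _ fun i => posSemidef_conj hρ.1 (K i)).trans
      (hK.sum_roofInf_le hα₀ hα₁ hρ.1)

end Measure

end TotalConcurrence

theorem corollary2 (α : ℝ) (hα₀ : 0 ≤ α) (hα₁ : α ≤ 1 / 2) :
    (∀ (m n : ℕ) (ρ : TotalConcurrence.BiMat m n), TotalConcurrence.IsState ρ →
      IsGLB (TotalConcurrence.roofValues (TotalConcurrence.pureConc α) ρ)
        (TotalConcurrence.mixedConc α m n ρ)) ∧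
    TotalConcurrence.IsEntanglementMeasure (TotalConcurrence.mixedConc α) := by
  refine ⟨fun m n ρ hρ => ?_, TotalConcurrence.isEntanglementMeasure_mixedConc hα₀ hα₁⟩
  rw [TotalConcurrence.mixedConc, TotalConcurrence.roofValues_eq_homRoof hρ]
  exact isGLB_csInf (TotalConcurrence.homRoof_nonempty hρ.1)
    (TotalConcurrence.bddBelow_homRoof hα₁ ρ)
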